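/- For $n\ge 1$ let $\mathbb{H}^n=\{x\in\mathbb{R}^{n+1}: x_0^2-x_1^2-\cdots-x_n^2=1,\ x_0>0\}$ be hyperbolic $n$-space, with $\mathrm{Isom}(\mathbb{H}^n)=\mathrm{O}(1,n)^+$. A Salem number is a real algebraic integer $\lambda>1$ whose Galois conjugates off the unit circle are precisely $\lambda$ and $\lambda^{-1}$ (degree $2$ is allowed). It is square-rootable over $\mathbb{Q}$ if its minimal polynomial $f$ over $\mathbb{Q}$ satisfies $f(x^2)=g(x)g(-x)$ for some monic palindromic polynomial $g$ whose even-degree coefficients lie in $\mathbb{Q}$ and whose odd-degree coefficients lie in $\sqrt{\alpha}\,\mathbb{Q}$, for some rational $\alpha>0$. Let $\mathrm{Sal}^{sq}_m$ be the set of Salem numbers of degree $2m$ that are square-rootable over $\mathbb{Q}$. Let $K\subset\mathbb{R}$ be a totally real number field. A quadratic form $q$ over $K$ of rank $n+1$ is admissible if it has signature $(1,n)$ over $\mathbb{R}$ and $q^\sigma$ is definite for every embedding $\sigma:K\to\mathbb{R}$ other than the inclusion. Subgroups $\Gamma_1,\Gamma_2$ of $\mathrm{Isom}(\mathbb{H}^n)$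 are commensurable if for some $g\in\mathrm{Isom}(\mathbb{H}^n)$ the group $g\Gamma_1g^{-1}\cap\Gamma_2$ has finite index in both $g\Gamma_1g^{-1}$ and $\Gamma_2$. A subgroup of $\mathrm{Isom}(\mathbb{H}^n)$ is arithmetic of the first type, defined over $K$, if it is commensurable with $\mathrm{SO}_q(\mathcal{O}_K)$ for some admissible $q$ over $K$, where $\mathrm{SO}_q(\mathcal O_K)$ is regarded, up to finite index, as a subgroup of $\mathrm{Isom}(\mathbb{H}^n)$ through a real equivalence of $q$ with $x_0^2-x_1^2-\cdots-x_n^2$; $K$ is then a field of definition of its commensurability class. A commensurability class realizes $\lambda$ if some group $\Gamma$ in the class contains a loxodromic element $\gamma$ with $\lambda=e^{\ell(\gamma)}$, where $\ell(\gamma)=\inf_{x\in\mathbb{H}^n}d(\gamma x,x)$ is the translation length. **Proposition.** Let $\mathfrak{C}$ be a commensurability class of arithmetic groups of the first type in $\mathrm{Isom}(\mathbb{H}^n)$, and let $m$ be an integer with $2\le 2m\le n+1$. If $\mathfrak{C}$ realizes all Salem numbers in $\mathrm{Sal}^{sq}_m$, then the field of definition of $\mathfrak{C}$ is $\mathbb{Q}$;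 that is, $\mathfrak{C}$ is defined over a totally real number field $K\subset\mathbb{R}$ if and only if $K=\mathbb{Q}$. -/

import Mathlib

open Polynomial Matrix NumberField IntermediateField

noncomputable section

namespace HypArith

/-! ### Salem numbers and square-rootable Salem numbers -/

/-- A Salem number: a real algebraic integer `l > 1` whose Galois conjugates off the unit circle
are precisely `l` and `l⁻¹` (degree two is allowed). -/
def IsSalem (l : ℝ) : Prop :=
  IsIntegral ℤ l ∧ 1 < l ∧
    {z : ℂ | z ∈ (minpoly ℚ l).aroots ℂ ∧ ‖z‖ ≠ 1} = {(l : ℂ), ((l⁻¹ : ℝ) : ℂ)}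

/-- Square-rootability of `l` over a number field `K` given with an embedding into `ℝ`
(the algebra map): `K ⊆ ℚ(l + l⁻¹)`, and there are a totally positive `a ∈ K` and a monic
palindromic polynomial `g`, with coefficients of even degree in `K` and coefficients of odd degree
in `√a K`, such that `f(x²) = g(x) g(-x)`, where `f` is the minimal polynomial of `l` over `K`. -/
def IsSquareRootable (K : Type*) [Field K] [Algebra K ℝ] (l : ℝ) : Prop :=
  Set.range (algebraMap K ℝ) ⊆ (ℚ⟮l + l⁻¹⟯ : Set ℝ) ∧
  ∃ a : K, (∀ σ : K →+* ℝ, 0 < σ a) ∧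
  ∃ g : ℝ[X], g.Monic ∧ g.reverse = g ∧
    (∀ k, Even k → ∃ c : K, g.coeff k = algebraMap K ℝ c) ∧
    (∀ k, Odd k → ∃ c : K, g.coeff k = √(algebraMap K ℝ a) * algebraMap K ℝ c) ∧
    ((minpoly K l).map (algebraMap K ℝ)).comp (X ^ 2) = g * g.comp (-X)

/-- The set of Salem numbers of degree `2m` that are square-rootable over `ℚ`. -/
def SalSq (m : ℕ) : Set ℝ :=
  {l | IsSalem l ∧ (minpoly ℚ l).natDegree = 2 * m ∧ IsSquareRootable ℚ l}

/-! ### Hyperbolic space and its isometries: the hyperboloid model -/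

/-- The matrix `diag(1, -1, …, -1)` of size `n + 1`. -/
def lorentzMatrix (n : ℕ) : Matrix (Fin (n + 1)) (Fin (n + 1)) ℝ :=
  Matrix.diagonal (Fin.cons 1 fun _ => -1)

/-- The Lorentz bilinear form `x₀y₀ - x₁y₁ - ⋯ - xₙyₙ`. -/
def lorentzForm {n : ℕ} (x y : Fin (n + 1) → ℝ) : ℝ := x ⬝ᵥ (lorentzMatrix n *ᵥ y)

/-- Hyperbolic `n`-space: the upper sheet of the hyperboloid. -/
def hyperboloid (n : ℕ) : Set (Fin (n + 1) → ℝ) := {x | lorentzForm x x = 1 ∧ 0 < x 0}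

/-- The hyperbolic distance: `cosh d(x, y)` is the Lorentz product of `x` and `y`. -/
def hypDist {n : ℕ} (x y : Fin (n + 1) → ℝ) : ℝ := Real.arcosh (lorentzForm x y)

/-- `Isom(ℍⁿ) = O(1,n)⁺`: the matrices `A` with `Aᵀ J A = J` that preserve the upper sheet. -/
def IsomH (n : ℕ) : Subgroup (GL (Fin (n + 1)) ℝ) where
  carrier := {A | A.valᵀ * lorentzMatrix n * A.val = lorentzMatrix n ∧
    ∀ x, A.val *ᵥ x ∈ hyperboloid n ↔ x ∈ hyperboloid n}
  one_mem' := by simp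
  mul_mem' := by
    rintro A B ⟨hA, hA'⟩ ⟨hB, hB'⟩
    refine ⟨?_, fun x => ?_⟩
    · calc (A * B).valᵀ * lorentzMatrix n * (A * B).val
          = B.valᵀ * (A.valᵀ * lorentzMatrix n * A.val) * B.val := by
            simp [Matrix.transpose_mul, Matrix.mul_assoc]
        _ = lorentzMatrix n := by rw [hA, hB]
    · rw [Units.val_mul, ← Matrix.mulVec_mulVec, hA', hB']
  inv_mem' := by
    rintro A ⟨hA, hA'⟩
    have h1 : A.val * (A⁻¹).val = 1 := by rw [← Units.val_mul, mul_inv_cancel, Units.val_one]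
    refine ⟨?_, fun x => ?_⟩
    · calc (A⁻¹).valᵀ * lorentzMatrix n * (A⁻¹).val
          = (A⁻¹).valᵀ * (A.valᵀ * lorentzMatrix n * A.val) * (A⁻¹).val := by rw [hA]
        _ = (A.val * (A⁻¹).val)ᵀ * lorentzMatrix n * (A.val * (A⁻¹).val) := by
            simp only [Matrix.transpose_mul, Matrix.mul_assoc]
        _ = lorentzMatrix n := by rw [h1]; simp
    · rw [← hA', Matrix.mulVec_mulVec, h1, Matrix.one_mulVec]

/-- The points of the boundary at infinity fixed by `γ`: a boundary point is a light-like line,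
i.e. a line spanned by a non-zero isotropic vector. -/
def fixedBoundaryPoints {n : ℕ} (γ : IsomH n) : Set (Submodule ℝ (Fin (n + 1) → ℝ)) :=
  {p | (∃ v, v ≠ 0 ∧ lorentzForm v v = 0 ∧ p = Submodule.span ℝ {v}) ∧
    p.map (Matrix.mulVecLin γ.val.val) = p}

/-- A loxodromic isometry: no fixed point in `ℍⁿ` and exactly two in the boundary. -/
def IsLoxodromic {n : ℕ} (γ : IsomH n) : Prop :=
  (∀ x ∈ hyperboloid n, γ.val.val *ᵥ x ≠ x) ∧ (fixedBoundaryPoints γ).ncard = 2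

/-- The translation length `inf_{x ∈ ℍⁿ} d(γ x, x)`. -/
def translationLength {n : ℕ} (γ : IsomH n) : ℝ :=
  ⨅ x : hyperboloid n, hypDist (γ.val.val *ᵥ x.val) x.val

/-- `Γ` realizes `l`: some loxodromic `γ ∈ Γ` satisfies `l = exp (ℓ(γ))`. -/
def Realizes {n : ℕ} (Γ : Subgroup (IsomH n)) (l : ℝ) : Prop :=
  ∃ γ ∈ Γ, IsLoxodromic γ ∧ l = Real.exp (translationLength γ)

/-- Commensurability in `Isom(ℍⁿ)`: `g Γ₁ g⁻¹ ∩ Γ₂` has finite index in `g Γ₁ g⁻¹` and in `Γ₂`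
for some `g`. -/
def AreCommensurable {n : ℕ} (Γ₁ Γ₂ : Subgroup (IsomH n)) : Prop :=
  ∃ g : IsomH n, Subgroup.Commensurable (Γ₁.map (MulAut.conj g).toMonoidHom) Γ₂

/-! ### Arithmetic groups of the first type

A quadratic form of rank `n + 1` over `K` is given by its symmetric Gram matrix `S`. -/

/-- `S` is admissible: it has signature `(1, n)` over `ℝ` (through the inclusion `K ⊆ ℝ`),
and its image under any other embedding `K → ℝ` is (positive or negative) definite. -/
def IsAdmissible {n : ℕ} (K : IntermediateField ℚ ℝ)
    (S : Matrix (Fin (n + 1)) (Fin (n + 1)) K) : Prop :=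
  S.IsSymm ∧
  (∃ M : GL (Fin (n + 1)) ℝ,
    M.valᵀ * S.map (algebraMap K ℝ) * M.val = lorentzMatrix n) ∧
  ∀ σ : K →+* ℝ, σ ≠ algebraMap K ℝ → (S.map σ).PosDef ∨ (-(S.map σ)).PosDef

/-- The group `SO_q(𝓞 K)` of the quadratic form with Gram matrix `S`. -/
def integralSO {n : ℕ} {K : IntermediateField ℚ ℝ}
    (S : Matrix (Fin (n + 1)) (Fin (n + 1)) K) :
    Subgroup (Matrix.SpecialLinearGroup (Fin (n + 1)) (𝓞 K)) where
  carrier := {B | (B.val.map (algebraMap (𝓞 K) K))ᵀ * S * B.val.map (algebraMap (𝓞 K) K) = S}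
  one_mem' := by simp
  mul_mem' := by
    intro A B hA hB
    simp only [Set.mem_ofPred_eq, Matrix.SpecialLinearGroup.coe_mul, Matrix.map_mul] at hA hB ⊢
    set a := A.val.map (algebraMap (𝓞 K) K)
    set b := B.val.map (algebraMap (𝓞 K) K)
    calc (a * b)ᵀ * S * (a * b) = bᵀ * (aᵀ * S * a) * b := by
          simp only [Matrix.transpose_mul, Matrix.mul_assoc]
      _ = S := by rw [hA, hB]
  inv_mem' := by
    intro A hA
    simp only [Set.mem_ofPred_eq] at hA ⊢
    have h1 : A.val.map (algebraMap (𝓞 K) K) * (A⁻¹).val.map (algebraMap (𝓞 K) K) = 1 := by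
      rw [← Matrix.map_mul, ← Matrix.SpecialLinearGroup.coe_mul, mul_inv_cancel]
      simp
    set a := A.val.map (algebraMap (𝓞 K) K)
    set b := (A⁻¹).val.map (algebraMap (𝓞 K) K)
    calc bᵀ * S * b = bᵀ * (aᵀ * S * a) * b := by rw [hA]
      _ = (a * b)ᵀ * S * (a * b) := by simp only [Matrix.transpose_mul, Matrix.mul_assoc]
      _ = S := by rw [h1]; simp

/-- The inclusion `SL(𝓞 K) → GL(ℝ)` induced by `𝓞 K ⊆ K ⊆ ℝ`. -/
def slToGLReal {n : ℕ} (K : IntermediateField ℚ ℝ) :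
    Matrix.SpecialLinearGroup (Fin (n + 1)) (𝓞 K) →* GL (Fin (n + 1)) ℝ :=
  Matrix.SpecialLinearGroup.toGL.comp
    (Matrix.SpecialLinearGroup.map ((algebraMap K ℝ).comp (algebraMap (𝓞 K) K)))

/-- `SO_q(𝓞 K)` as a group of isometries of `ℍⁿ`. If the real change of coordinates `M` takes `q`
to the Lorentz form, then `A ↦ M⁻¹ A M` takes `SO_q(𝓞 K)` into `O(1,n)`, and those of its elements
that preserve the upper sheet (a subgroup of index at most two) act on `ℍⁿ`. -/
def integralIsometries {n : ℕ} {K : IntermediateField ℚ ℝ}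
    (S : Matrix (Fin (n + 1)) (Fin (n + 1)) K) (M : GL (Fin (n + 1)) ℝ) :
    Subgroup (IsomH n) :=
  (((integralSO S).map (slToGLReal K)).map (MulAut.conj M⁻¹).toMonoidHom).subgroupOf (IsomH n)

/-- `Γ` is an arithmetic subgroup of `Isom(ℍⁿ)` of the first type defined over the totally real
number field `K ⊆ ℝ`: it is commensurable with `SO_q(𝓞 K)` for some admissible `q` over `K`. -/
def IsArithmeticFirstType {n : ℕ} (K : IntermediateField ℚ ℝ) (Γ : Subgroup (IsomH n)) : Prop :=
  NumberField K ∧ IsTotallyReal K ∧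
  ∃ S : Matrix (Fin (n + 1)) (Fin (n + 1)) K, IsAdmissible K S ∧
  ∃ M : GL (Fin (n + 1)) ℝ,
    M.valᵀ * S.map (algebraMap K ℝ) * M.val = lorentzMatrix n ∧
    AreCommensurable Γ (integralIsometries S M)

/-- `C` is a commensurability class of arithmetic groups of the first type defined over `K`. -/
def IsFirstTypeClass {n : ℕ} (K : IntermediateField ℚ ℝ) (C : Set (Subgroup (IsomH n))) : Prop :=
  ∃ Γ₀, IsArithmeticFirstType K Γ₀ ∧ C = {Γ | AreCommensurable Γ Γ₀}

/-- A class realizes `l` if some group in the class does. -/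
def ClassRealizes {n : ℕ} (C : Set (Subgroup (IsomH n))) (l : ℝ) : Prop :=
  ∃ Γ ∈ C, Realizes Γ l

end HypArith

end

/-!
Let the class be defined over `K`, and let it realize `l`.

The translation length of a loxodromic isometry is attained on its axis, so `l` is an eigenvalue
of some element of a group in the class (`exists_eigenvector_exp_translationLength`). A power `l^k`
is then an eigenvalue of an integral isometry of an admissible form over `K`. A conjugation that
moves `K` turns this form into a definite one and therefore sends `l^k` to the unit circle; but a
conjugation that fixes `l + l⁻¹` sends `l` to `l` or `l⁻¹`. Hence `K ⊆ ℚ(l + l⁻¹)`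
(`le_adjoin_add_inv_of_realizes`).

It remains to find enough square-rootable Salem numbers to exclude every `K ≠ ℚ`. For each prime
`p` the polynomial `salemPoly m p` is palindromic of degree `2m` and Eisenstein at `p` in the
variable `X - 1`. Its values on the unit circle are governed by a real trigonometric function with
many sign changes, so all its roots except one real `s > 1` and `s⁻¹` lie on the unit circle
(`root_salemPoly`). The square of a Salem number `s` is square-rootable with `a = 1`, since
`f(x²) = g(x) g(-x)` for the minimal polynomials `f` of `s²` and `g` of `s` (`sq_mem_SalSq`).

Thus `K ⊆ ℚ(s)`, where `p` is totally ramified. For an algebraic integer `θ ∈ K` this makes all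
conjugates of `θ` congruent modulo the primes above `p`
(`dvd_coeff_zero_minpoly_sub_of_isEisensteinAt`). As `p` is arbitrary, `θ` has only one conjugate,
and `K = ℚ` (`eq_bot_of_forall_le_adjoin`).
-/

namespace HypArith

/-! ### Loxodromic isometries and their translation length -/

theorem lorentzForm_eq {n : ℕ} (x y : Fin (n + 1) → ℝ) :
    lorentzForm x y = x 0 * y 0 - ∑ i : Fin n, x i.succ * y i.succ := by
  simp [lorentzForm, lorentzMatrix, Matrix.mulVec_diagonal, dotProduct, Fin.sum_univ_succ,
    sub_eq_add_neg]

theorem lorentzForm_comm {n : ℕ} (x y : Fin (n + 1) → ℝ) :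
    lorentzForm x y = lorentzForm y x := by
  simp only [lorentzForm_eq, mul_comm]

theorem lorentzForm_add_left {n : ℕ} (x y z : Fin (n + 1) → ℝ) :
    lorentzForm (x + y) z = lorentzForm x z + lorentzForm y z := by
  simp [lorentzForm, add_dotProduct]

theorem lorentzForm_smul_left {n : ℕ} (a : ℝ) (x y : Fin (n + 1) → ℝ) :
    lorentzForm (a • x) y = a * lorentzForm x y := by
  simp [lorentzForm, smul_dotProduct]

theorem lorentzForm_sub_left {n : ℕ} (x y z : Fin (n + 1) → ℝ) :
    lorentzForm (x - y) z = lorentzForm x z - lorentzForm y z := by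
  simp [lorentzForm, sub_dotProduct]

theorem lorentzForm_add_right {n : ℕ} (x y z : Fin (n + 1) → ℝ) :
    lorentzForm x (y + z) = lorentzForm x y + lorentzForm x z := by
  simp [lorentzForm, mulVec_add]

theorem lorentzForm_smul_right {n : ℕ} (a : ℝ) (x y : Fin (n + 1) → ℝ) :
    lorentzForm x (a • y) = a * lorentzForm x y := by
  simp [lorentzForm, mulVec_smul]

theorem lorentzForm_sub_right {n : ℕ} (x y z : Fin (n + 1) → ℝ) :
    lorentzForm x (y - z) = lorentzForm x y - lorentzForm x z := by
  simp [lorentzForm, mulVec_sub]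

theorem lorentzForm_mulVec {n : ℕ} (γ : IsomH n) (x y : Fin (n + 1) → ℝ) :
    lorentzForm (γ.val.val *ᵥ x) (γ.val.val *ᵥ y) = lorentzForm x y := by
  have h := γ.2.1
  unfold lorentzForm
  conv_rhs => rw [← h]
  rw [← vecMul_transpose, ← dotProduct_mulVec, mulVec_mulVec, mulVec_mulVec, Matrix.mul_assoc]

/-- The orthogonal complement of a point of hyperbolic space is negative semidefinite. -/
theorem lorentzForm_self_nonpos {n : ℕ} {x u : Fin (n + 1) → ℝ} (hx : x ∈ hyperboloid n)
    (hu : lorentzForm u x = 0) : lorentzForm u u ≤ 0 := by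
  obtain ⟨hx1, hx0⟩ := hx
  rw [lorentzForm_eq] at hx1 hu ⊢
  have hcs := Finset.sum_mul_sq_le_sq_mul_sq Finset.univ (fun i : Fin n => u i.succ)
    (fun i => x i.succ)
  simp only [← sq] at hx1 ⊢
  set a := ∑ i : Fin n, u i.succ * x i.succ
  set b := ∑ i : Fin n, u i.succ ^ 2
  set c := ∑ i : Fin n, x i.succ ^ 2
  have hb : 0 ≤ b := Finset.sum_nonneg fun i _ => sq_nonneg _
  have ha : a = u 0 * x 0 := by linarith
  have hc : c = x 0 ^ 2 - 1 := by linarith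
  rw [ha, hc] at hcs
  have : x 0 ^ 2 * (u 0 ^ 2 - b) ≤ 0 := by nlinarith
  by_contra! hlt
  have : 0 < x 0 ^ 2 * (u 0 ^ 2 - b) := by positivity
  linarith

/-- Among isotropic vectors with first coordinate `1`, distinct ones have positive Lorentz
product: it is half the squared Euclidean distance. -/
theorem lorentzForm_pos_of_isotropic {n : ℕ} {v w : Fin (n + 1) → ℝ} (hv0 : v 0 = 1)
    (hw0 : w 0 = 1) (hv : lorentzForm v v = 0) (hw : lorentzForm w w = 0) (hvw : v ≠ w) :
    0 < lorentzForm v w := by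
  have h : lorentzForm (v - w) (v - w) = -2 * lorentzForm v w := by
    simp only [lorentzForm_sub_left, lorentzForm_sub_right, hv, hw, lorentzForm_comm w v]; ring
  rw [lorentzForm_eq (v - w)] at h
  simp only [Pi.sub_apply, hv0, hw0, sub_self, ← sq] at h
  have : 0 < ∑ i : Fin n, (v i.succ - w i.succ) ^ 2 := by
    refine lt_of_le_of_ne (Finset.sum_nonneg fun i _ => sq_nonneg _) fun h0 => hvw ?_
    rw [eq_comm, Finset.sum_eq_zero_iff_of_nonneg fun i _ => sq_nonneg _] at h0
    ext i
    refine Fin.cases (hv0.trans hw0.symm) (fun j => ?_) i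
    have := h0 j (Finset.mem_univ j)
    nlinarith [pow_eq_zero_iff (two_ne_zero) |>.1 this]
  linarith

/-- A fixed boundary point is spanned by an isotropic eigenvector with first coordinate `1`. -/
theorem exists_eigenvector_of_mem_fixedBoundaryPoints {n : ℕ} {γ : IsomH n}
    {P : Submodule ℝ (Fin (n + 1) → ℝ)} (hP : P ∈ fixedBoundaryPoints γ) :
    ∃ v : Fin (n + 1) → ℝ, v 0 = 1 ∧ lorentzForm v v = 0 ∧ P = Submodule.span ℝ {v} ∧
      ∃ μ : ℝ, γ.val.val *ᵥ v = μ • v := by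
  obtain ⟨⟨v, hv, hvv, rfl⟩, hfix⟩ := hP
  have hv0 : v 0 ≠ 0 := by
    intro h0
    apply hv
    rw [lorentzForm_eq, h0, mul_zero, zero_sub, neg_eq_zero] at hvv
    simp only [← sq] at hvv
    rw [Finset.sum_eq_zero_iff_of_nonneg fun i _ => sq_nonneg _] at hvv
    ext i
    exact Fin.cases h0 (fun j => pow_eq_zero_iff two_ne_zero |>.1 (hvv j (Finset.mem_univ j))) i
  refine ⟨(v 0)⁻¹ • v, by simp [hv0], by simp [lorentzForm_smul_left, lorentzForm_smul_right, hvv],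
    ?_, ?_⟩
  · exact (Submodule.span_singleton_smul_eq (isUnit_iff_ne_zero.2 (inv_ne_zero hv0)) v).symm
  · have : γ.val.val *ᵥ v ∈ Submodule.span ℝ {v} := by
      have h := Submodule.mem_map_of_mem (f := Matrix.mulVecLin γ.val.val)
        (Submodule.mem_span_singleton_self (R := ℝ) v)
      rw [hfix] at h
      exact h
    obtain ⟨μ, hμ⟩ := Submodule.mem_span_singleton.1 this
    exact ⟨μ, by rw [mulVec_smul, ← hμ, smul_comm]⟩

/-- The displacement of `γ` is least on the axis joining the two fixed points at infinity: if
`v`, `w` are isotropic eigenvectors for `μ` and `μ⁻¹`, with `v + w` on the axis, then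
`cosh d(γ y, y) ≥ cosh (log μ)`. -/
theorem le_lorentzForm_mulVec_self {n : ℕ} {γ : IsomH n} {v w : Fin (n + 1) → ℝ} {μ : ℝ}
    (hμ : 0 < μ) (hv : lorentzForm v v = 0) (hw : lorentzForm w w = 0)
    (hvw : lorentzForm v w = 1 / 2) (hγv : γ.val.val *ᵥ v = μ • v)
    (hγw : γ.val.val *ᵥ w = μ⁻¹ • w) (hx : v + w ∈ hyperboloid n) {y : Fin (n + 1) → ℝ}
    (hy : lorentzForm y y = 1) :
    (μ + μ⁻¹) / 2 ≤ lorentzForm (γ.val.val *ᵥ y) y := by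
  set A := γ.val.val
  -- Decompose `y = a v + b w + u` with `u` orthogonal to the axis.
  set a := 2 * lorentzForm y w with ha
  set b := 2 * lorentzForm y v with hb
  set u := y - a • v - b • w with hu
  have hwv : lorentzForm w v = 1 / 2 := by rw [lorentzForm_comm, hvw]
  have huv : lorentzForm u v = 0 := by
    simp only [hu, lorentzForm_sub_left, lorentzForm_smul_left, hv, hwv]; linarith
  have huw : lorentzForm u w = 0 := by
    simp only [hu, lorentzForm_sub_left, lorentzForm_smul_left, hw, hvw]; linarith
  have hvu : lorentzForm v u = 0 := by rw [lorentzForm_comm, huv]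
  have hwu : lorentzForm w u = 0 := by rw [lorentzForm_comm, huw]
  have hAuv : lorentzForm (A *ᵥ u) v = 0 := by
    have := lorentzForm_mulVec γ u v
    rw [hγv, lorentzForm_smul_right, huv] at this
    exact (mul_eq_zero.1 this).resolve_left hμ.ne'
  have hAuw : lorentzForm (A *ᵥ u) w = 0 := by
    have := lorentzForm_mulVec γ u w
    rw [hγw, lorentzForm_smul_right, huw] at this
    exact (mul_eq_zero.1 this).resolve_left (inv_ne_zero hμ.ne')
  have hAuu : lorentzForm (A *ᵥ u) (A *ᵥ u) = lorentzForm u u := lorentzForm_mulVec γ u u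
  have hyd : y = a • v + b • w + u := by rw [hu]; abel
  have hab : a * b + lorentzForm u u = 1 := by
    rw [← hy]
    conv_rhs => rw [hyd]
    simp only [lorentzForm_add_left, lorentzForm_add_right, lorentzForm_smul_left,
      lorentzForm_smul_right, hv, hw, hvw, hwv, huv, huw, hvu, hwu]
    ring
  have hAy : lorentzForm (A *ᵥ y) y = a * b * ((μ + μ⁻¹) / 2) + lorentzForm (A *ᵥ u) u := by
    conv_lhs => rw [hyd]
    simp only [mulVec_add, mulVec_smul, A, hγv, hγw, lorentzForm_add_left, lorentzForm_add_right,
      lorentzForm_smul_left, lorentzForm_smul_right, hv, hw, hvw, hwv, hvu, hwu] 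
    simp only [A] at hAuv hAuw
    rw [hAuv, hAuw]
    ring
  have hneg : lorentzForm u u ≤ 0 := lorentzForm_self_nonpos hx (by
    rw [lorentzForm_add_right, huv, huw, add_zero])
  have hsum : lorentzForm (A *ᵥ u - u) (A *ᵥ u - u) ≤ 0 := lorentzForm_self_nonpos hx (by
    simp only [lorentzForm_add_right, lorentzForm_sub_left, huv, huw, hAuv, hAuw]; ring)
  have hsum' : lorentzForm (A *ᵥ u + u) (A *ᵥ u + u) ≤ 0 := lorentzForm_self_nonpos hx (by
    simp only [lorentzForm_add_right, lorentzForm_add_left, huv, huw, hAuv, hAuw]; ring)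
  simp only [lorentzForm_add_left, lorentzForm_add_right, lorentzForm_sub_left,
    lorentzForm_sub_right, hAuu, lorentzForm_comm u (A *ᵥ u)] at hsum hsum'
  have hμ2 : 1 ≤ (μ + μ⁻¹) / 2 := by
    have h1 : μ * μ⁻¹ = 1 := mul_inv_cancel₀ hμ.ne'
    have h2 : 0 < μ⁻¹ := inv_pos.2 hμ
    nlinarith [sq_nonneg (μ - μ⁻¹)]
  rw [hAy]
  nlinarith

/-- The exponential of the translation length of a loxodromic isometry is an eigenvalue. -/
theorem exists_eigenvector_exp_translationLength {n : ℕ} {γ : IsomH n} (hγ : IsLoxodromic γ) :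
    ∃ v : Fin (n + 1) → ℝ, v ≠ 0 ∧
      γ.val.val *ᵥ v = Real.exp (translationLength γ) • v := by
  obtain ⟨-, h2⟩ := hγ
  obtain ⟨P, Q, hPQ, hset⟩ := Set.ncard_eq_two.1 h2
  obtain ⟨v, hv0, hv, hPv, μ, hγv⟩ :=
    exists_eigenvector_of_mem_fixedBoundaryPoints (γ := γ) (P := P) (by simp [hset])
  obtain ⟨w, hw0, hw, hQw, ν, hγw⟩ :=
    exists_eigenvector_of_mem_fixedBoundaryPoints (γ := γ) (P := Q) (by simp [hset])
  have hvw : v ≠ w := by rintro rfl; exact hPQ (hPv.trans hQw.symm)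
  have hc := lorentzForm_pos_of_isotropic hv0 hw0 hv hw hvw
  have hμν : μ * ν = 1 := by
    have := lorentzForm_mulVec γ v w
    rw [hγv, hγw, lorentzForm_smul_left, lorentzForm_smul_right, ← mul_assoc] at this
    exact mul_right_cancel₀ hc.ne' (this.trans (one_mul _).symm)
  -- Rescale so that the sum of the two eigenvectors lies on the hyperboloid.
  obtain ⟨r, hr, hr2⟩ : ∃ r : ℝ, 0 < r ∧ r ^ 2 * lorentzForm v w = 1 / 2 :=
    ⟨√(1 / (2 * lorentzForm v w)), by positivity, by
      rw [Real.sq_sqrt (by positivity)]; field_simp⟩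
  have hx : r • v + r • w ∈ hyperboloid n := by
    constructor
    · simp only [lorentzForm_add_left, lorentzForm_add_right, lorentzForm_smul_left,
        lorentzForm_smul_right, hv, hw, lorentzForm_comm w v]
      nlinarith
    · simp [hv0, hw0, hr]
  have hγx := (γ.2.2 (r • v + r • w)).2 hx
  have hμ : 0 < μ := by
    have h0 := hγx.2
    rw [mulVec_add, mulVec_smul, mulVec_smul, hγv, hγw] at h0
    simp only [Pi.add_apply, Pi.smul_apply, smul_eq_mul, hv0, hw0, mul_one] at h0
    have : 0 < μ + ν := by by_contra! h; nlinarith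
    nlinarith [sq_nonneg ν, sq_nonneg μ]
  obtain rfl : ν = μ⁻¹ := eq_inv_of_mul_eq_one_right hμν
  have hγrv : γ.val.val *ᵥ (r • v) = μ • (r • v) := by rw [mulVec_smul, hγv, smul_comm]
  have hγrw : γ.val.val *ᵥ (r • w) = μ⁻¹ • (r • w) := by rw [mulVec_smul, hγw, smul_comm]
  have hrv : lorentzForm (r • v) (r • v) = 0 := by
    rw [lorentzForm_smul_left, lorentzForm_smul_right, hv]; simp
  have hrw : lorentzForm (r • w) (r • w) = 0 := by
    rw [lorentzForm_smul_left, lorentzForm_smul_right, hw]; simp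
  have hrvw : lorentzForm (r • v) (r • w) = 1 / 2 := by
    rw [lorentzForm_smul_left, lorentzForm_smul_right, ← hr2]; ring
  have hcosh : (μ + μ⁻¹) / 2 = Real.cosh |Real.log μ| := by
    rw [Real.cosh_abs, Real.cosh_eq, Real.exp_log hμ, Real.exp_neg, Real.exp_log hμ]
  have hpos : 0 < (μ + μ⁻¹) / 2 := by positivity
  have hle : ∀ y : hyperboloid n, |Real.log μ| ≤ hypDist (γ.val.val *ᵥ y.val) y.val := by
    intro y
    have h := le_lorentzForm_mulVec_self hμ hrv hrw hrvw hγrv hγrw hx y.2.1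
    rw [← Real.arcosh_cosh (abs_nonneg (Real.log μ)), ← hcosh]
    exact (Real.arcosh_le_arcosh hpos (hpos.trans_le h)).2 h
  have hlen : translationLength γ = |Real.log μ| := by
    have : Nonempty (hyperboloid n) := ⟨⟨_, hx⟩⟩
    refine le_antisymm ?_ (le_ciInf hle)
    refine (ciInf_le ⟨|Real.log μ|, by rintro _ ⟨y, rfl⟩; exact hle y⟩ ⟨_, hx⟩).trans_eq ?_
    have hwv : lorentzForm (r • w) (r • v) = 1 / 2 := by rw [lorentzForm_comm, hrvw]
    rw [hypDist, mulVec_add, hγrv, hγrw]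
    rw [← Real.arcosh_cosh (abs_nonneg (Real.log μ)), ← hcosh]
    congr 1
    simp only [lorentzForm_add_left, lorentzForm_add_right, lorentzForm_smul_left μ,
      lorentzForm_smul_left μ⁻¹, hrv, hrw, hrvw, hwv]
    ring
  have hne : ∀ z : Fin (n + 1) → ℝ, z 0 = 1 → z ≠ 0 := by rintro z h rfl; simp at h
  rcases abs_choice (Real.log μ) with h | h
  · exact ⟨v, hne v hv0, by rw [hlen, h, Real.exp_log hμ, hγv]⟩
  · exact ⟨w, hne w hw0, by rw [hlen, h, Real.exp_neg, Real.exp_log hμ, hγw]⟩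

/-! ### Eigenvalues of arithmetic groups -/

/-- Commensurable groups have the same elements up to conjugation and powers. -/
theorem AreCommensurable.exists_conj_pow_mem {n : ℕ} {Γ₁ Γ₂ : Subgroup (IsomH n)}
    (h : AreCommensurable Γ₁ Γ₂) {γ : IsomH n} (hγ : γ ∈ Γ₁) :
    ∃ g : IsomH n, ∃ k : ℕ, 0 < k ∧ g * γ ^ k * g⁻¹ ∈ Γ₂ := by
  obtain ⟨g, -, hg⟩ := h
  obtain ⟨k, hk, -, hmem⟩ := Subgroup.exists_pow_mem_of_relIndex_ne_zero hg
    (Subgroup.mem_map_of_mem (MulAut.conj g).toMonoidHom hγ)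
  refine ⟨g, k, hk, ?_⟩
  rw [← conj_pow]
  exact hmem.1

theorem exists_mulVec_eq_smul_iff {ι F : Type*} [Fintype ι] [DecidableEq ι] [Field F]
    (A : Matrix ι ι F) (z : F) :
    (∃ v, v ≠ 0 ∧ A *ᵥ v = z • v) ↔ A.charpoly.eval z = 0 := by
  rw [eval_charpoly, ← exists_mulVec_eq_zero_iff]
  refine exists_congr fun v => and_congr_right fun _ => ?_
  rw [sub_mulVec, sub_eq_zero, scalar_apply, ← smul_one_eq_diagonal, smul_mulVec, one_mulVec,
    eq_comm]

/-- If a class of arithmetic groups defined over `K` realizes `l`, then a power of `l` is an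
eigenvalue of an isometry over `K` of an admissible form. -/
theorem exists_eval_charpoly_pow_eq_zero {n : ℕ} {K : IntermediateField ℚ ℝ}
    {C : Set (Subgroup (IsomH n))} (hC : IsFirstTypeClass K C) {l : ℝ} (hl : ClassRealizes C l) :
    ∃ S B : Matrix (Fin (n + 1)) (Fin (n + 1)) K, IsAdmissible K S ∧ Bᵀ * S * B = S ∧
      ∃ k : ℕ, 0 < k ∧ (B.map (algebraMap K ℝ)).charpoly.eval (l ^ k) = 0 := by
  obtain ⟨Γ₀, ⟨-, -, S, hS, M, -, hΓ₀⟩, rfl⟩ := hC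
  obtain ⟨Γ, hΓ, γ, hγ, hlox, rfl⟩ := hl
  obtain ⟨v, hv, hγv⟩ := exists_eigenvector_exp_translationLength hlox
  set l := Real.exp (translationLength γ)
  obtain ⟨g₁, k₁, hk₁, h₁⟩ := AreCommensurable.exists_conj_pow_mem hΓ hγ
  obtain ⟨g₂, k₂, hk₂, h₂⟩ := AreCommensurable.exists_conj_pow_mem hΓ₀ h₁
  obtain ⟨_, ⟨B, hB, rfl⟩, hBM⟩ := h₂
  refine ⟨S, B.val.map (algebraMap (𝓞 K) K), hS, hB, k₁ * k₂, by positivity, ?_⟩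
  rw [← exists_mulVec_eq_smul_iff]
  have hpow : ∀ k : ℕ, (γ.val ^ k).val *ᵥ v = l ^ k • v := by
    intro k
    induction k with
    | zero => simp
    | succ k ih =>
      rw [pow_succ, Units.val_mul, ← mulVec_mulVec, hγv, mulVec_smul, ih, smul_smul, pow_succ']
  have hconj : slToGLReal K B * (M * g₂.val * g₁.val) =
      (M * g₂.val * g₁.val) * γ.val ^ (k₁ * k₂) := by
    simp only [MulEquiv.coe_toMonoidHom, MulAut.conj_apply, conj_pow, inv_inv,
      Subgroup.coe_subtype, Subgroup.coe_mul, Subgroup.coe_inv, Subgroup.coe_pow] at hBM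
    rw [pow_mul]
    calc slToGLReal K B * (M * g₂.val * g₁.val)
        = M * (M⁻¹ * slToGLReal K B * M) * g₂.val * g₁.val := by group
      _ = _ := by rw [hBM]; group
  refine ⟨(M * g₂.val * g₁.val).val *ᵥ v, ?_, ?_⟩
  · intro h0
    apply hv
    have := congrArg (fun u => ((M * g₂.val * g₁.val)⁻¹).val *ᵥ u) h0
    simpa only [mulVec_mulVec, ← Units.val_mul, inv_mul_cancel, Units.val_one, one_mulVec,
      mulVec_zero] using this
  · have h := congrArg (fun A : GL (Fin (n + 1)) ℝ => A.val *ᵥ v) hconj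
    simp only [Units.val_mul _ (γ.val ^ _), Units.val_mul (slToGLReal K B),
      ← mulVec_mulVec _ _ (γ.val ^ _).val, hpow, mulVec_smul] at h
    rw [← h, mulVec_mulVec]
    rfl

/-- Isometries of a definite real form have all their complex eigenvalues on the unit circle. -/
theorem norm_eq_one_of_posDef {ι : Type*} [Fintype ι] [DecidableEq ι] {S B : Matrix ι ι ℝ}
    (hS : S.PosDef) (hB : Bᵀ * S * B = S) {z : ℂ}
    (hz : (B.map (algebraMap ℝ ℂ)).charpoly.eval z = 0) : ‖z‖ = 1 := by
  obtain ⟨v, hv, hBv⟩ := (exists_mulVec_eq_smul_iff _ _).2 hz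
  -- The Hermitian extension of `S` takes the value `S(Re v) + S(Im v)` at `v`.
  have hpos : star v ⬝ᵥ (S.map (algebraMap ℝ ℂ)) *ᵥ v ≠ 0 := by
    intro h0
    have hre : (fun i => (v i).re) ⬝ᵥ S *ᵥ (fun i => (v i).re) +
        (fun i => (v i).im) ⬝ᵥ S *ᵥ (fun i => (v i).im) = 0 := by
      have := congrArg Complex.re h0
      simpa [dotProduct, mulVec, Complex.re_sum, Complex.im_sum, Finset.sum_add_distrib]
        using this
    have hnn : ∀ u : ι → ℝ, 0 ≤ u ⬝ᵥ S *ᵥ u := fun u => by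
      simpa using hS.posSemidef.dotProduct_mulVec_nonneg u
    have hz0 : ∀ u : ι → ℝ, u ⬝ᵥ S *ᵥ u = 0 → u = 0 := fun u hu => by
      by_contra hne
      have := hS.dotProduct_mulVec_pos hne
      simp [hu] at this
    have h1 := hz0 (fun i => (v i).re) (by
      linarith [hnn fun i => (v i).re, hnn fun i => (v i).im])
    have h2 := hz0 (fun i => (v i).im) (by
      linarith [hnn fun i => (v i).re, hnn fun i => (v i).im])
    exact hv (funext fun i => Complex.ext (congrFun h1 i) (congrFun h2 i))
  have hB' : (B.map (algebraMap ℝ ℂ))ᴴ * S.map (algebraMap ℝ ℂ) * B.map (algebraMap ℝ ℂ) =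
      S.map (algebraMap ℝ ℂ) := by
    conv_rhs => rw [← hB]
    rw [Matrix.map_mul, Matrix.map_mul]
    congr 2
    ext i j
    simp
  have hinv : star v ⬝ᵥ (S.map (algebraMap ℝ ℂ)) *ᵥ v =
      (star z * z) * (star v ⬝ᵥ (S.map (algebraMap ℝ ℂ)) *ᵥ v) := by
    conv_lhs => rw [← hB', ← mulVec_mulVec, ← mulVec_mulVec, dotProduct_mulVec,
      ← star_mulVec, hBv]
    simp only [star_smul, mulVec_smul, smul_dotProduct, dotProduct_smul, smul_eq_mul]
    ring
  have h1 : star z * z = 1 := by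
    exact (mul_right_cancel₀ hpos ((one_mul _).trans hinv)).symm
  have h2 : (‖z‖ : ℂ) ^ 2 = 1 := by rw [← h1, ← Complex.conj_mul']; rfl
  have h3 : ‖z‖ ^ 2 = 1 := by exact_mod_cast h2
  exact (pow_eq_one_iff_of_nonneg (norm_nonneg z) two_ne_zero).1 h3

/-- A conjugate of an eigenvalue of an isometry of an admissible form lies on the unit circle as
soon as the conjugation moves the base field. -/
theorem IsAdmissible.norm_eq_one {n : ℕ} {K : IntermediateField ℚ ℝ} [NumberField K]
    [IsTotallyReal K] {S B : Matrix (Fin (n + 1)) (Fin (n + 1)) K} (hS : IsAdmissible K S)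
    (hB : Bᵀ * S * B = S) {φ : K →+* ℂ} (hφ : ∃ x : K, φ x ≠ ((x : ℝ) : ℂ)) {z : ℂ}
    (hz : (B.map φ).charpoly.eval z = 0) : ‖z‖ = 1 := by
  have hreal := IsTotallyReal.complexEmbedding_isReal φ
  set σ := ComplexEmbedding.IsReal.embedding hreal
  have hσ : ∀ x, (algebraMap ℝ ℂ) (σ x) = φ x := fun x =>
    ComplexEmbedding.IsReal.coe_embedding_apply hreal x
  have hne : σ ≠ algebraMap K ℝ := by
    rintro h
    obtain ⟨x, hx⟩ := hφ
    exact hx (by rw [← hσ, h]; rfl)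
  have hBσ : B.map φ = (B.map σ).map (algebraMap ℝ ℂ) := by
    ext i j
    simp [← hσ]
  rw [hBσ] at hz
  have hinv : (B.map σ)ᵀ * S.map σ * B.map σ = S.map σ := by
    conv_rhs => rw [← hB]
    simp [Matrix.map_mul, transpose_map]
  rcases hS.2.2 σ hne with h | h
  · exact norm_eq_one_of_posDef h hinv hz
  · exact norm_eq_one_of_posDef h (by simp [hinv]) hz

theorem exists_conjugate_ne {F : Type*} [Field F] [CharZero F] [Algebra F ℝ] [Algebra F ℂ]
    [IsScalarTower F ℝ ℂ] {θ : ℝ} (hθ : IsIntegral F θ) (hmem : θ ∉ Set.range (algebraMap F ℝ)) :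
    ∃ θ' : ℂ, aeval θ' (minpoly F θ) = 0 ∧ θ' ≠ θ := by
  have hmin : minpoly F (θ : ℂ) = minpoly F θ :=
    minpoly.algebraMap_eq (algebraMap ℝ ℂ).injective θ
  have hsep : IsSeparable F (θ : ℂ) := by
    rw [IsSeparable, hmin]
    exact (minpoly.irreducible hθ).separable
  have hbot : (θ : ℂ) ∉ (⊥ : Subalgebra F ℂ) := by
    rw [Algebra.mem_bot]
    rintro ⟨e, he⟩
    rw [IsScalarTower.algebraMap_apply F ℝ ℂ] at he
    exact hmem ⟨e, Complex.ofReal_injective he⟩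
  obtain ⟨θ', hne, hθ'⟩ :=
    (notMem_iff_exists_ne_and_isConjRoot hsep (IsAlgClosed.splits _)).1 hbot
  exact ⟨θ', hmin ▸ hθ'.aeval_eq_zero, hne.symm⟩

/-- The field of definition of a class that realizes an algebraic number `l > 1` lies in
`ℚ(l + l⁻¹)`. -/
theorem le_adjoin_add_inv_of_realizes {n : ℕ} {K : IntermediateField ℚ ℝ}
    {C : Set (Subgroup (IsomH n))} (hC : IsFirstTypeClass K C) {l : ℝ} (hint : IsIntegral ℚ l)
    (hl : 1 < l) (hreal : ClassRealizes C l) : K ≤ ℚ⟮l + l⁻¹⟯ := by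
  obtain ⟨S, B, hS, hB, k, hk, hev⟩ := exists_eval_charpoly_pow_eq_zero hC hreal
  obtain ⟨Γ₀, ⟨hNF, hTR, -⟩, -⟩ := hC
  intro θ hθ
  by_contra hθE
  set E := ℚ⟮l + l⁻¹⟯
  have hlint : IsIntegral E l := hint.tower_top
  have hKint : ∀ x ∈ K, IsIntegral ℚ x := fun x hx =>
    (isIntegral_iff (S := K) (x := ⟨x, hx⟩)).1 (Algebra.IsIntegral.isIntegral _)
  have hθint : IsIntegral E θ := (hKint θ hθ).tower_top
  -- `θ ∉ E` has a second conjugate over `E`.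
  obtain ⟨θ', hθ', hne⟩ : ∃ θ' : ℂ, aeval θ' (minpoly E θ) = 0 ∧ θ' ≠ θ :=
    exists_conjugate_ne hθint fun ⟨e, he⟩ => hθE (he ▸ e.2)
  let T : Set ℝ := insert l K
  have hθT : θ ∈ adjoin E T := subset_adjoin E T (Set.mem_insert_of_mem _ hθ)
  obtain ⟨φ, hφ⟩ := exists_algHom_adjoin_of_splits_of_aeval (F := E) (S := T) (K := ℂ)
    (fun s hs => ⟨by
      rcases hs with rfl | hs
      · exact hlint
      · exact (hKint s hs).tower_top, IsAlgClosed.splits _⟩) hθT hθ'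
  have hlT : l ∈ adjoin E T := subset_adjoin E T (Set.mem_insert _ _)
  let ι : K →+* adjoin E T := (algebraMap K ℝ).codRestrict (adjoin E T).toSubring
    fun x => subset_adjoin E T (Set.mem_insert_of_mem _ x.2)
  have hcirc : ‖φ ⟨l, hlT⟩ ^ k‖ = 1 := by
    refine hS.norm_eq_one hB (φ := φ.toRingHom.comp ι) ⟨⟨θ, hθ⟩, ?_⟩ ?_
    · rw [← hφ] at hne
      exact hne
    · have h1 : B.charpoly.eval₂ ι (⟨l, hlT⟩ ^ k) = 0 := by
        apply (adjoin E T).val.injective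
        rw [charpoly_map, eval_map] at hev
        rw [map_zero, ← hev]
        exact hom_eval₂ _ ι (adjoin E T).val.toRingHom _
      rw [charpoly_map, eval_map]
      have h2 := hom_eval₂ B.charpoly ι φ.toRingHom (⟨l, hlT⟩ ^ k)
      rw [h1, map_zero, map_pow] at h2
      exact h2.symm
  rw [norm_pow, pow_eq_one_iff_of_nonneg (norm_nonneg _) hk.ne'] at hcirc
  -- `φ` fixes `l + l⁻¹`, so it permutes `l` and `l⁻¹`.
  have hl0 : l ≠ 0 := by positivity
  have hsum : φ ⟨l, hlT⟩ + (φ ⟨l, hlT⟩)⁻¹ = l + (l : ℂ)⁻¹ := by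
    have h1 := φ.commutes ⟨l + l⁻¹, mem_adjoin_simple_self ℚ _⟩
    have h2 : algebraMap E (adjoin E T) ⟨l + l⁻¹, mem_adjoin_simple_self ℚ _⟩ =
      ⟨l, hlT⟩ + ⟨l, hlT⟩⁻¹ := rfl
    have h3 : algebraMap E ℂ ⟨l + l⁻¹, mem_adjoin_simple_self ℚ _⟩ = ((l + l⁻¹ : ℝ) : ℂ) := rfl
    rw [h2, h3, map_add, map_inv₀] at h1
    simpa using h1
  set z := φ ⟨l, hlT⟩
  have hz0 : z ≠ 0 := by rintro h; simp [h] at hcirc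
  have hlC : (l : ℂ) ≠ 0 := by exact_mod_cast hl0
  have hprod : (z - l) * (z * l - 1) = 0 := by
    field_simp at hsum
    linear_combination hsum
  rcases mul_eq_zero.1 hprod with h | h
  · rw [sub_eq_zero.1 h, Complex.norm_real, Real.norm_of_nonneg (by positivity)] at hcirc
    exact hl.ne' hcirc
  · have := congrArg norm (sub_eq_zero.1 h)
    rw [norm_mul, hcirc, Complex.norm_real, Real.norm_of_nonneg (by positivity)] at this
    simp [hl.ne'] at this

/-! ### A family of Salem polynomials -/

/-- The palindromic polynomial
`(X - 1)^(2m) - p X^m - p² 4^m (X + X³ + ⋯ + X^(2m-1))`. It is Eisenstein at `p` in the variable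
`X - 1`, and the last summand is large enough to force all its roots but two onto the unit circle. -/
noncomputable def salemPoly (m p : ℕ) : ℤ[X] :=
  (X - 1) ^ (2 * m) - (C (p : ℤ) * X ^ m +
    C ((p : ℤ) ^ 2 * 4 ^ m) * ∑ j ∈ Finset.range m, X ^ (2 * j + 1))

theorem degree_salemPoly_tail_lt {m : ℕ} (hm : 0 < m) (p : ℕ) :
    (C (p : ℤ) * X ^ m + C ((p : ℤ) ^ 2 * 4 ^ m) * ∑ j ∈ Finset.range m, X ^ (2 * j + 1) :
      ℤ[X]).degree < (2 * m : ℕ) := by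
  rw [← mem_degreeLT]
  refine Submodule.add_mem _ ?_ ?_
  · rw [mem_degreeLT]
    exact (degree_C_mul_X_pow_le _ _).trans_lt (by exact_mod_cast (by lia : m < 2 * m))
  · rw [← smul_eq_C_mul]
    refine Submodule.smul_mem _ _ (Submodule.sum_mem _ fun j hj => ?_)
    rw [mem_degreeLT, degree_X_pow]
    have := Finset.mem_range.1 hj
    exact_mod_cast (by lia : 2 * j + 1 < 2 * m)

theorem degree_X_sub_one_pow (k : ℕ) : ((X - 1 : ℤ[X]) ^ k).degree = k := by
  rw [← C_1, degree_pow, degree_X_sub_C]; simp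

theorem monic_salemPoly {m : ℕ} (hm : 0 < m) (p : ℕ) : (salemPoly m p).Monic := by
  refine Monic.sub_of_left ?_ ?_
  · rw [← C_1]; exact (monic_X_sub_C 1).pow _
  · rw [degree_X_sub_one_pow]; exact degree_salemPoly_tail_lt hm p

theorem natDegree_salemPoly {m : ℕ} (hm : 0 < m) (p : ℕ) :
    (salemPoly m p).natDegree = 2 * m := by
  refine natDegree_eq_of_degree_eq_some ?_
  rw [salemPoly, degree_sub_eq_left_of_degree_lt, degree_X_sub_one_pow]
  rw [degree_X_sub_one_pow]; exact degree_salemPoly_tail_lt hm p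

theorem reflect_X_sub_one_pow (m : ℕ) :
    reflect (2 * m) ((X - 1 : ℤ[X]) ^ (2 * m)) = (X - 1) ^ (2 * m) := by
  have h : ∀ k : ℕ, reflect k ((X - 1 : ℤ[X]) ^ k) = (1 - X) ^ k := by
    intro k
    induction k with
    | zero => simp
    | succ k ih =>
      rw [pow_succ, reflect_mul, ih, pow_succ, reflect_sub, reflect_one_X, reflect_one, pow_one]
      · rw [← C_1]; exact natDegree_pow_le_of_le k (natDegree_X_sub_C_le 1) |>.trans (by simp)
      · rw [← C_1]; exact natDegree_X_sub_C_le 1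
  rw [h, ← neg_sub, Even.neg_pow (even_two_mul m)]

theorem reflect_salemPoly (m p : ℕ) : reflect (2 * m) (salemPoly m p) = salemPoly m p := by
  have hsum : reflect (2 * m) (∑ j ∈ Finset.range m, (X : ℤ[X]) ^ (2 * j + 1)) =
      ∑ j ∈ Finset.range m, X ^ (2 * j + 1) := by
    have h : ∀ s : Finset ℕ, reflect (2 * m) (∑ j ∈ s, (X : ℤ[X]) ^ (2 * j + 1)) =
        ∑ j ∈ s, X ^ revAt (2 * m) (2 * j + 1) := by
      intro s
      induction s using Finset.induction_on with
      | empty => simp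
      | insert a s ha ih => rw [Finset.sum_insert ha, Finset.sum_insert ha, reflect_add, ih,
          reflect_monomial]
    rw [h, ← Finset.sum_range_reflect]
    refine Finset.sum_congr rfl fun j hj => ?_
    have := Finset.mem_range.1 hj
    rw [revAt_le (by lia)]
    congr 1
    lia
  rw [salemPoly, reflect_sub, reflect_add, reflect_X_sub_one_pow, reflect_C_mul, reflect_C_mul,
    hsum, reflect_monomial, revAt_le (by lia)]
  congr 4
  lia

theorem eval_one_salemPoly {m : ℕ} (hm : 0 < m) (p : ℕ) :
    (salemPoly m p).eval 1 = -p - p ^ 2 * 4 ^ m * m := by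
  simp [salemPoly, eval_finsetSum, hm.ne']
  ring

/-- In the variable `X - 1` the polynomial is Eisenstein at `p`. -/
theorem isEisensteinAt_salemPoly_comp {m p : ℕ} (hm : 0 < m) (hp : p.Prime) :
    ((salemPoly m p).comp (X + 1)).IsEisensteinAt (Ideal.span {(p : ℤ)}) := by
  have hpZ : Prime (p : ℤ) := Nat.prime_iff_prime_int.1 hp
  have hmon : ((salemPoly m p).comp (X + 1)).Monic := by
    rw [← C_1]; exact (monic_salemPoly hm p).comp_X_add_C 1
  have hdeg : ((salemPoly m p).comp (X + 1)).natDegree = 2 * m := by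
    rw [natDegree_comp, natDegree_salemPoly hm, ← C_1, natDegree_X_add_C, mul_one]
  refine ⟨?_, fun {n} hn => ?_, ?_⟩
  · rw [hmon.leadingCoeff, Ideal.mem_span_singleton]
    exact fun h => hpZ.not_isUnit (isUnit_of_dvd_one h)
  · rw [hdeg] at hn
    have h : (salemPoly m p).comp (X + 1) = X ^ (2 * m) - C (p : ℤ) * ((X + 1) ^ m +
        C ((p : ℤ) * 4 ^ m) * ∑ j ∈ Finset.range m, (X + 1) ^ (2 * j + 1)) := by
      simp [salemPoly, Finset.sum_comp]
      ring
    rw [h, coeff_sub, coeff_X_pow, if_neg hn.ne, zero_sub, Ideal.mem_span_singleton, coeff_C_mul]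
    exact (dvd_mul_right _ _).neg_right
  · rw [coeff_zero_eq_eval_zero, eval_comp, eval_add, eval_X, eval_one, zero_add,
      eval_one_salemPoly hm, Ideal.span_singleton_pow, Ideal.mem_span_singleton]
    intro h
    have h1 : (p : ℤ) ^ 2 ∣ p := by
      have := dvd_add h (dvd_mul_right ((p : ℤ) ^ 2) (4 ^ m * m))
      rw [show (-p - p ^ 2 * 4 ^ m * m + p ^ 2 * (4 ^ m * m) : ℤ) = -p by ring] at this
      exact (dvd_neg.1 this)
    rw [sq] at h1
    have h2 : (p : ℤ) ∣ 1 := by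
      refine (mul_dvd_mul_iff_left hpZ.ne_zero).1 ?_
      rwa [mul_one]
    exact hpZ.not_isUnit (isUnit_of_dvd_one h2)

theorem irreducible_salemPoly {m p : ℕ} (hm : 0 < m) (hp : p.Prime) :
    Irreducible (salemPoly m p) := by
  have hpZ : Prime (p : ℤ) := Nat.prime_iff_prime_int.1 hp
  have h : Irreducible ((salemPoly m p).comp (X + 1)) := by
    refine (isEisensteinAt_salemPoly_comp hm hp).irreducible
      ((Ideal.span_singleton_prime hpZ.ne_zero).2 hpZ) ?_ ?_
    · rw [← C_1]; exact ((monic_salemPoly hm p).comp_X_add_C 1).isPrimitive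
    · rw [natDegree_comp, natDegree_salemPoly hm, ← C_1, natDegree_X_add_C]; lia
  have h' := (MulEquiv.irreducible_iff (algEquivAevalXAddC (1 : ℤ)) (x := salemPoly m p)).1
  simp only [algEquivAevalXAddC_apply] at h'
  exact h' (by rwa [← comp_eq_aeval, C_1])

/-! ### The roots on the unit circle -/

theorem aeval_salemPoly {R : Type*} [CommRing R] (m p : ℕ) (z : R) :
    aeval z (salemPoly m p) = (z - 1) ^ (2 * m) - (p * z ^ m +
      p ^ 2 * 4 ^ m * ∑ j ∈ Finset.range m, z ^ (2 * j + 1)) := by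
  simp only [salemPoly, map_sub, map_pow, map_add, map_mul, aeval_X, map_sum, aeval_C, map_one]
  simp

/-- The real trigonometric function that governs the values of the polynomial on the unit
circle. -/
noncomputable def salemTrig (m p : ℕ) (t : ℝ) : ℝ :=
  Real.sin t * ((2 * Real.cos t - 2) ^ m - p) - p ^ 2 * 4 ^ m * Real.sin (m * t)

/-- With `z = exp (i t)` one has `z² - 1 = 2 i z sin t`, `(z - 1)² = z (2 cos t - 2)` and
`z^(2m) - 1 = 2 i z^m sin (m t)`; the last factor comes from summing the geometric series. -/
theorem aeval_exp_salemPoly (m p : ℕ) (t : ℝ) :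
    (Complex.exp (t * Complex.I) ^ 2 - 1) * aeval (Complex.exp (t * Complex.I)) (salemPoly m p) =
      Complex.exp (t * Complex.I) ^ (m + 1) * (2 * Complex.I) * salemTrig m p t := by
  set z := Complex.exp (t * Complex.I) with hz
  have hz0 : z ≠ 0 := Complex.exp_ne_zero _
  have hzc : z = Complex.cos t + Complex.sin t * Complex.I := Complex.exp_mul_I _
  have hI := Complex.I_sq
  have hsc := Complex.sin_sq_add_cos_sq t
  have h1 : (z - 1) ^ 2 = z * (2 * Complex.cos t - 2) := by
    rw [hzc]; linear_combination (Complex.sin t) ^ 2 * hI - hsc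
  have h2 : z ^ 2 - 1 = z * (2 * Complex.I * Complex.sin t) := by
    rw [hzc]; linear_combination (-(Complex.sin t) ^ 2) * hI + hsc
  have h3 : z ^ (2 * m) - 1 = z ^ m * (2 * Complex.I * Complex.sin (m * t)) := by
    have hzm : z ^ m = Complex.cos (m * t) + Complex.sin (m * t) * Complex.I := by
      rw [hz, ← Complex.exp_nat_mul, ← Complex.exp_mul_I, mul_assoc]
    rw [mul_comm 2 m, pow_mul, hzm]
    linear_combination (-(Complex.sin (m * t)) ^ 2) * hI + Complex.sin_sq_add_cos_sq (m * t)
  have h4 : (z ^ 2 - 1) * ∑ j ∈ Finset.range m, z ^ (2 * j + 1) = z * (z ^ (2 * m) - 1) := by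
    have := mul_geom_sum (z ^ 2) m
    simp only [pow_succ z (2 * _), ← Finset.sum_mul, pow_mul z 2]
    linear_combination z * this
  rw [aeval_salemPoly, salemTrig]
  push_cast
  rw [pow_mul, h1, mul_pow]
  linear_combination (z ^ m * (2 * Complex.cos t - 2) ^ m - p * z ^ m) * h2 -
    p ^ 2 * 4 ^ m * h4 - p ^ 2 * 4 ^ m * z * h3

/-- At the odd multiples of `π / 2m` the dominant term `p² 4^m sin (m t)` takes its extreme values,
so the signs alternate. -/
theorem salemTrig_alternates {m p : ℕ} (hm : 0 < m) (hp : 2 ≤ p) (j : ℕ) :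
    (-1) ^ j * salemTrig m p ((2 * j + 1) * Real.pi / (2 * m)) < 0 := by
  set t := (2 * j + 1) * Real.pi / (2 * m) with ht
  have hmR : (m : ℝ) ≠ 0 := by positivity
  have hsin : Real.sin (m * t) = (-1) ^ j := by
    rw [show (m : ℝ) * t = j * Real.pi + Real.pi / 2 by rw [ht]; field_simp,
      Real.sin_add_pi_div_two, Real.cos_nat_mul_pi]
  have hj : ((-1 : ℝ) ^ j) * (-1) ^ j = 1 := by rw [← mul_pow]; simp
  have hb : |(-1) ^ j * (Real.sin t * ((2 * Real.cos t - 2) ^ m - p))| ≤ 4 ^ m + p := by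
    rw [abs_mul, abs_pow, abs_neg, abs_one, one_pow, one_mul, abs_mul]
    have h1 : |2 * Real.cos t - 2| ^ m ≤ 4 ^ m := by
      refine pow_le_pow_left₀ (abs_nonneg _) ?_ m
      rw [abs_le]
      constructor <;> linarith [Real.cos_le_one t, Real.neg_one_le_cos t]
    calc |Real.sin t| * |(2 * Real.cos t - 2) ^ m - p|
        ≤ 1 * |(2 * Real.cos t - 2) ^ m - p| :=
          mul_le_mul_of_nonneg_right (Real.abs_sin_le_one t) (abs_nonneg _)
      _ ≤ |(2 * Real.cos t - 2) ^ m| + |(p : ℝ)| := by rw [one_mul]; exact abs_sub _ _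
      _ ≤ 4 ^ m + p := by rw [abs_pow, Nat.abs_cast]; linarith
  have hN : (4 : ℝ) ^ m + p < p ^ 2 * 4 ^ m := by
    have h1 : (1 : ℝ) ≤ 4 ^ m := one_le_pow₀ (by norm_num)
    have h2 : (2 : ℝ) ≤ p := by exact_mod_cast hp
    nlinarith [mul_le_mul_of_nonneg_left h1 (by nlinarith : (0 : ℝ) ≤ p ^ 2 - 1)]
  rw [salemTrig, hsin, mul_sub]
  have := (le_abs_self _).trans hb
  have h5 : (-1 : ℝ) ^ j * (p ^ 2 * 4 ^ m * (-1) ^ j) = p ^ 2 * 4 ^ m := by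
    linear_combination p ^ 2 * 4 ^ m * hj
  linarith

theorem exists_salemTrig_eq_zero {m p : ℕ} (hm : 0 < m) (hp : 2 ≤ p) (j : ℕ) :
    ∃ t ∈ Set.Ioo ((2 * j + 1) * Real.pi / (2 * m)) ((2 * j + 3) * Real.pi / (2 * m)),
      salemTrig m p t = 0 := by
  have h1 := salemTrig_alternates hm hp j
  have h2 := salemTrig_alternates hm hp (j + 1)
  rw [pow_succ, show (2 * ((j + 1 : ℕ) : ℝ) + 1) = 2 * j + 3 by push_cast; ring] at h2
  have hcont : Continuous fun t => (-1) ^ j * salemTrig m p t := by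
    unfold salemTrig; fun_prop
  have hle : (2 * (j : ℝ) + 1) * Real.pi / (2 * m) ≤ (2 * j + 3) * Real.pi / (2 * m) := by
    gcongr; linarith
  obtain ⟨t, ht, h0⟩ := intermediate_value_Ioo hle hcont.continuousOn
    ⟨h1, (by linarith : (0 : ℝ) < (-1) ^ j * salemTrig m p ((2 * j + 3) * Real.pi / (2 * m)))⟩
  exact ⟨t, ht, (mul_eq_zero.1 h0).resolve_left (pow_ne_zero _ (by norm_num))⟩

/-- At least `2m - 2` roots lie on the unit circle. -/
theorem exists_unit_circle_roots {m p : ℕ} (hm : 0 < m) (hp : 2 ≤ p) :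
    ∃ U : Finset ℂ, U.card = 2 * m - 2 ∧
      ∀ z ∈ U, ‖z‖ = 1 ∧ aeval z (salemPoly m p) = 0 := by
  choose t ht ht0 using exists_salemTrig_eq_zero (p := p) hm hp
  have hmR : (0 : ℝ) < m := by positivity
  have hπ := Real.pi_pos
  have hlt : ∀ {i j : ℕ}, i < j → t i < t j := by
    intro i j hij
    refine (ht i).2.trans (lt_of_le_of_lt ?_ (ht j).1)
    have : (i : ℝ) + 1 ≤ j := by exact_mod_cast hij
    exact div_le_div_of_nonneg_right (mul_le_mul_of_nonneg_right (by linarith) hπ.le)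
      (by positivity)
  have hpos : ∀ j, 0 < t j := fun j => lt_trans (by positivity) (ht j).1
  have hlt2 : ∀ j, j < 2 * m - 1 → t j < 2 * Real.pi := by
    intro j hj
    refine (ht j).2.trans_le ?_
    have : (j : ℝ) + 2 ≤ 2 * m := by exact_mod_cast (by lia : j + 2 ≤ 2 * m)
    rw [div_le_iff₀ (by positivity)]
    nlinarith
  -- The interval with index `m - 1` contains the spurious zero `π`, and is left out.
  refine ⟨((Finset.range (2 * m - 1)).erase (m - 1)).image fun j => Complex.exp (t j * Complex.I),
    ?_, ?_⟩
  · rw [Finset.card_image_of_injOn, Finset.card_erase_of_mem, Finset.card_range]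
    · lia
    · rw [Finset.mem_range]; lia
    · intro i hi j hj hij
      simp only [Finset.coe_erase, Finset.coe_range, Set.mem_sdiff, Set.mem_Iio] at hi hj
      obtain ⟨n, hn⟩ := Complex.exp_eq_exp_iff_exists_int.1 hij
      have hn' : t i = t j + n * (2 * Real.pi) := by
        have h : (t i : ℂ) * Complex.I = ((t j + n * (2 * Real.pi) : ℝ) : ℂ) * Complex.I := by
          rw [hn]; push_cast; ring
        exact_mod_cast mul_right_cancel₀ Complex.I_ne_zero h
      have hn0 : n = 0 := by
        have h1 : (n : ℝ) < 1 := by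
          by_contra! h
          nlinarith [hlt2 i hi.1, hpos j]
        have h2 : (-1 : ℝ) < n := by
          by_contra! h
          nlinarith [hlt2 j hj.1, hpos i]
        have h1' : n < 1 := by exact_mod_cast h1
        have h2' : -1 < n := by exact_mod_cast h2
        lia
      rw [hn0, Int.cast_zero, zero_mul, add_zero] at hn'
      rcases lt_trichotomy i j with h | h | h
      · exact absurd hn' (hlt h).ne
      · exact h
      · exact absurd hn' (hlt h).ne'
  · intro z hz
    obtain ⟨j, hj, rfl⟩ := Finset.mem_image.1 hz
    rw [Finset.mem_erase, Finset.mem_range] at hj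
    refine ⟨Complex.norm_exp_ofReal_mul_I _, ?_⟩
    have h := aeval_exp_salemPoly m p (t j)
    rw [ht0 j, Complex.ofReal_zero, mul_zero] at h
    refine (mul_eq_zero.1 h).resolve_left fun h1 => ?_
    have hsin : Real.sin (t j) = 0 := by
      have h2 : Complex.exp (t j * Complex.I) = Complex.exp (-(t j * Complex.I)) := by
        rw [Complex.exp_neg]
        exact eq_inv_of_mul_eq_one_left (by linear_combination h1)
      have h3 : Complex.sin (t j) = 0 := by
        rw [Complex.sin, neg_mul, ← h2]; simp
      exact_mod_cast h3
    rcases lt_or_gt_of_ne hj.1 with h | h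
    · refine (Real.sin_pos_of_pos_of_lt_pi (hpos j) ((ht j).2.trans_le ?_)).ne' hsin
      have : (j : ℝ) + 2 ≤ m := by exact_mod_cast (by lia : j + 2 ≤ m)
      rw [div_le_iff₀ (by positivity)]
      nlinarith
    · have h1 : 0 < t j - Real.pi := by
        have : (m : ℝ) ≤ j := by exact_mod_cast (by lia : m ≤ j)
        refine sub_pos.2 (lt_of_le_of_lt ?_ (ht j).1)
        rw [le_div_iff₀ (by positivity)]
        nlinarith
      refine (Real.sin_pos_of_pos_of_lt_pi h1 (by linarith [hlt2 j hj.2])).ne' ?_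
      rw [Real.sin_sub_pi, hsin, neg_zero]

/-! ### The resulting Salem numbers -/

theorem exists_real_root_salemPoly {m p : ℕ} (hm : 0 < m) (hp : 2 ≤ p) :
    ∃ s : ℝ, 1 < s ∧ aeval s (salemPoly m p) = 0 := by
  have hmon : ((salemPoly m p).map (Int.castRingHom ℝ)).Monic := (monic_salemPoly hm p).map _
  have hev : ∀ x : ℝ, ((salemPoly m p).map (Int.castRingHom ℝ)).eval x =
      aeval x (salemPoly m p) := fun x => by rw [eval_map, aeval_def]; rfl
  have hdeg : 0 < ((salemPoly m p).map (Int.castRingHom ℝ)).degree := by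
    rw [← natDegree_pos_iff_degree_pos, (monic_salemPoly hm p).natDegree_map,
      natDegree_salemPoly hm]
    lia
  have htend := tendsto_atTop_of_leadingCoeff_nonneg _ hdeg (by rw [hmon.leadingCoeff]; norm_num)
  obtain ⟨b, hb0, hb1⟩ := ((htend.eventually_gt_atTop 0).and
    (Filter.eventually_gt_atTop 1)).exists
  have h1 : ((salemPoly m p).map (Int.castRingHom ℝ)).eval 1 < 0 := by
    have h2 : (0 : ℝ) < p := by exact_mod_cast (by lia : 0 < p)
    have h3 : (0 : ℝ) < m := by exact_mod_cast hm
    rw [← map_one (Int.castRingHom ℝ), eval_map_apply, eval_one_salemPoly hm]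
    simp only [map_sub, map_neg, map_mul, map_pow, map_natCast, map_ofNat]
    have : (0 : ℝ) < p ^ 2 * 4 ^ m * m := by positivity
    linarith
  obtain ⟨s, hs, hs0⟩ := intermediate_value_Ioo hb1.le
    ((salemPoly m p).map (Int.castRingHom ℝ)).continuous.continuousOn ⟨h1, hb0⟩
  exact ⟨s, hs.1, (hev s).symm.trans hs0⟩

theorem aeval_neg_salemPoly_ne_zero {m p : ℕ} (hm : 0 < m) (hp : 2 ≤ p) {s : ℝ} (hs : 1 < s) :
    aeval (-s) (salemPoly m p) ≠ 0 := by
  have h0 : (0 : ℝ) < s := by linarith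
  have hp2 : (2 : ℝ) ≤ p := by exact_mod_cast hp
  have h4 : (1 : ℝ) ≤ 4 ^ m := one_le_pow₀ (by norm_num)
  have hsum : s ^ m ≤ ∑ j ∈ Finset.range m, s ^ (2 * j + 1) := by
    refine le_trans (pow_le_pow_right₀ hs.le (by lia : m ≤ 2 * (m - 1) + 1))
      (Finset.single_le_sum (f := fun j => s ^ (2 * j + 1)) (fun j _ => by positivity)
        (Finset.mem_range.2 (by lia : m - 1 < m)))
  have hneg : ∑ j ∈ Finset.range m, (-s) ^ (2 * j + 1) =
      - ∑ j ∈ Finset.range m, s ^ (2 * j + 1) := by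
    rw [← Finset.sum_neg_distrib]
    exact Finset.sum_congr rfl fun j _ => Odd.neg_pow ⟨j, rfl⟩ s
  have habs : (p : ℝ) * (-s) ^ m ≤ p * s ^ m := by
    refine mul_le_mul_of_nonneg_left ((le_abs_self _).trans_eq ?_) (by positivity)
    rw [abs_pow, abs_neg, abs_of_pos h0]
  have hbig : (p : ℝ) * s ^ m ≤ p ^ 2 * 4 ^ m * ∑ j ∈ Finset.range m, s ^ (2 * j + 1) := by
    refine mul_le_mul ?_ hsum (by positivity) (by positivity)
    nlinarith [mul_le_mul_of_nonneg_left h4 (by positivity : (0 : ℝ) ≤ p ^ 2)]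
  have hpos : 0 < (-s - 1) ^ (2 * m) := by
    rw [pow_mul]; exact pow_pos (by nlinarith) m
  rw [aeval_salemPoly, hneg]
  refine ne_of_gt ?_
  linarith

/-- The roots are `s`, `s⁻¹` and points of the unit circle: these are enough to exhaust the
degree. -/
theorem root_salemPoly {m p : ℕ} (hm : 0 < m) (hp : 2 ≤ p) {s : ℝ} (hs : 1 < s)
    (hs0 : aeval s (salemPoly m p) = 0) :
    aeval ((s : ℂ)⁻¹) (salemPoly m p) = 0 ∧
    ∀ z : ℂ, aeval z (salemPoly m p) = 0 → ‖z‖ = 1 ∨ z = s ∨ z = (s : ℂ)⁻¹ := by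
  obtain ⟨U, hUcard, hU⟩ := exists_unit_circle_roots hm hp
  have h0 : (0 : ℝ) < s := by linarith
  have hsC0 : (s : ℂ) ≠ 0 := by exact_mod_cast h0.ne'
  have hsC : aeval (s : ℂ) (salemPoly m p) = 0 := by
    have := congrArg (algebraMap ℝ ℂ) hs0
    rwa [map_zero, ← aeval_algebraMap_apply] at this
  have hinv : aeval ((s : ℂ)⁻¹) (salemPoly m p) = 0 := by
    let _ := invertibleOfNonzero hsC0
    have := (eval₂_reflect_eq_zero_iff (algebraMap ℤ ℂ) (s : ℂ) (2 * m) (salemPoly m p)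
      (natDegree_salemPoly hm p).le).2 hsC
    rwa [reflect_salemPoly, invOf_eq_inv] at this
  refine ⟨hinv, fun z hz => ?_⟩
  have hsn : ‖(s : ℂ)‖ = s := by rw [Complex.norm_real, Real.norm_of_nonneg h0.le]
  have h1 : (s : ℂ)⁻¹ ∉ U := fun h => by
    have := (hU _ h).1
    rw [norm_inv, hsn, inv_eq_one] at this
    exact hs.ne' this
  have h2 : (s : ℂ) ∉ insert (s : ℂ)⁻¹ U := fun h => by
    rcases Finset.mem_insert.1 h with h | h
    · have := congrArg norm h
      rw [norm_inv, hsn] at this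
      exact (inv_lt_one_of_one_lt₀ hs).not_ge (this ▸ hs.le)
    · exact hs.ne' (hsn.symm.trans (hU _ h).1)
  have hne : salemPoly m p ≠ 0 := (monic_salemPoly hm p).ne_zero
  have hmem : ∀ {w : ℂ}, w ∈ ((salemPoly m p).aroots ℂ).toFinset ↔
      aeval w (salemPoly m p) = 0 := fun {w} => by
    rw [Multiset.mem_toFinset, mem_aroots, and_iff_right hne]
  have hsub : insert (s : ℂ) (insert (s : ℂ)⁻¹ U) ⊆ ((salemPoly m p).aroots ℂ).toFinset := by
    intro w hw
    rw [hmem]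
    rcases Finset.mem_insert.1 hw with rfl | hw
    · exact hsC
    rcases Finset.mem_insert.1 hw with rfl | hw
    · exact hinv
    · exact (hU w hw).2
  have heq := Finset.eq_of_subset_of_card_le hsub (by
    rw [Finset.card_insert_of_notMem h2, Finset.card_insert_of_notMem h1, hUcard]
    refine (Multiset.toFinset_card_le _).trans ((card_roots' _).trans ?_)
    rw [(monic_salemPoly hm p).natDegree_map, natDegree_salemPoly hm]
    lia)
  rw [← hmem, ← heq, Finset.mem_insert, Finset.mem_insert] at hz
  rcases hz with h | h | h
  · exact Or.inr (Or.inl h)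
  · exact Or.inr (Or.inr h)
  · exact Or.inl (hU z h).1

theorem minpoly_salemPoly {m p : ℕ} (hm : 0 < m) (hp : p.Prime) {s : ℝ}
    (hs0 : aeval s (salemPoly m p) = 0) :
    minpoly ℚ s = (salemPoly m p).map (algebraMap ℤ ℚ) := by
  symm
  refine minpoly.eq_of_irreducible_of_monic ?_ ?_ ((monic_salemPoly hm p).map _)
  · exact (monic_salemPoly hm p).irreducible_iff_irreducible_map_fraction_map.1
      (irreducible_salemPoly hm hp)
  · rw [aeval_map_algebraMap, hs0]

theorem natDegree_minpoly_salemPoly {m p : ℕ} (hm : 0 < m) (hp : p.Prime) {s : ℝ}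
    (hs0 : aeval s (salemPoly m p) = 0) : (minpoly ℚ s).natDegree = 2 * m := by
  rw [minpoly_salemPoly hm hp hs0, (monic_salemPoly hm p).natDegree_map, natDegree_salemPoly hm]

/-- The minimal polynomials `g` of `s` and `f` of `s²` satisfy `f(x²) = g(x) g(-x)`. The reason is
that `g(x)` and `g(-x)` are coprime, `-s` not being a conjugate of `s`, and both divide `f(x²)`. -/
theorem minpoly_sq_comp_X_sq {m p : ℕ} (hm : 0 < m) (hp : p.Prime) {s : ℝ} (hs : 1 < s)
    (hs0 : aeval s (salemPoly m p) = 0) :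
    (minpoly ℚ (s ^ 2)).comp (X ^ 2) = minpoly ℚ s * (minpoly ℚ s).comp (-X) := by
  have hint : IsIntegral ℤ s := ⟨_, monic_salemPoly hm p, hs0⟩
  have hintQ : IsIntegral ℚ s := hint.tower_top
  have hdeg := natDegree_minpoly_salemPoly hm hp hs0
  have hirr := minpoly.irreducible hintQ
  have hmon := minpoly.monic hintQ
  have hdegneg : ((minpoly ℚ s).comp (-X)).natDegree = 2 * m := by
    rw [natDegree_comp, natDegree_neg, natDegree_X, mul_one, hdeg]
  have hmonneg : ((minpoly ℚ s).comp (-X)).Monic := by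
    rw [Monic, leadingCoeff_comp (by simp), hmon.leadingCoeff, hdeg, leadingCoeff_neg,
      leadingCoeff_X, one_mul, (even_two_mul m).neg_one_pow]
  have hd1 : minpoly ℚ s ∣ (minpoly ℚ (s ^ 2)).comp (X ^ 2) := by
    apply minpoly.dvd
    rw [aeval_comp, map_pow, aeval_X, minpoly.aeval]
  have hd2 : (minpoly ℚ s).comp (-X) ∣ (minpoly ℚ (s ^ 2)).comp (X ^ 2) := by
    obtain ⟨q, hq⟩ := hd1
    refine ⟨q.comp (-X), ?_⟩
    rw [← mul_comp, ← hq, comp_assoc, pow_comp, X_comp, neg_sq]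
  have hcop : IsCoprime (minpoly ℚ s) ((minpoly ℚ s).comp (-X)) := by
    refine (hirr.coprime_iff_not_dvd).2 fun h => ?_
    obtain ⟨q, hq⟩ := h
    have := congrArg (aeval s) hq
    rw [map_mul, minpoly.aeval, zero_mul, aeval_comp, map_neg, aeval_X,
      minpoly_salemPoly hm hp hs0, aeval_map_algebraMap] at this
    exact aeval_neg_salemPoly_ne_zero hm hp.two_le hs this
  have hle : (minpoly ℚ (s ^ 2)).natDegree ≤ 2 * m := by
    have : FiniteDimensional ℚ ℚ⟮s⟯ := adjoin.finiteDimensional hintQ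
    have h := minpoly.natDegree_le (A := ℚ) ((AdjoinSimple.gen ℚ s) ^ 2)
    rw [← minpoly.algebraMap_eq (algebraMap ℚ⟮s⟯ ℝ).injective, map_pow,
      AdjoinSimple.algebraMap_gen, adjoin.finrank hintQ, hdeg] at h
    exact h
  refine eq_of_monic_of_dvd_of_natDegree_le (hmon.mul hmonneg) ?_ (hcop.mul_dvd hd1 hd2) ?_
  · refine (minpoly.monic (hintQ.pow 2)).comp (monic_X_pow 2) (by simp)
  · rw [natDegree_comp, natDegree_X_pow, hmon.natDegree_mul hmonneg, hdeg, hdegneg]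
    lia

/-- The square of the root `s > 1` is a Salem number, square-rootable with `a = 1`. -/
theorem sq_mem_SalSq {m p : ℕ} (hm : 0 < m) (hp : p.Prime) {s : ℝ} (hs : 1 < s)
    (hs0 : aeval s (salemPoly m p) = 0) : s ^ 2 ∈ SalSq m := by
  have hint : IsIntegral ℤ s := ⟨_, monic_salemPoly hm p, hs0⟩
  have hintQ : IsIntegral ℚ s := hint.tower_top
  have hmon := minpoly.monic hintQ
  have h0 : (0 : ℝ) < s := by linarith
  have hcomp := minpoly_sq_comp_X_sq hm hp hs hs0
  have hdeg := natDegree_minpoly_salemPoly hm hp hs0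
  obtain ⟨hinv, hroots⟩ := root_salemPoly hm hp.two_le hs hs0
  have haev : ∀ w : ℂ, aeval w (minpoly ℚ s) = aeval w (salemPoly m p) := fun w => by
    rw [minpoly_salemPoly hm hp hs0, aeval_map_algebraMap]
  have hsq : ∀ w : ℂ, aeval (w ^ 2) (minpoly ℚ (s ^ 2)) =
      aeval w (salemPoly m p) * aeval (-w) (salemPoly m p) := fun w => by
    have := congrArg (aeval w) hcomp
    rwa [aeval_comp, map_pow, aeval_X, map_mul, aeval_comp, map_neg, aeval_X, haev, haev] at this
  refine ⟨⟨hint.pow 2, by nlinarith, ?_⟩, ?_, ?_⟩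
  · ext z
    have hne : minpoly ℚ (s ^ 2) ≠ 0 := minpoly.ne_zero (hintQ.pow 2)
    simp only [Set.mem_ofPred_eq, mem_aroots, Set.mem_insert_iff, Set.mem_singleton_iff]
    constructor
    · rintro ⟨⟨-, hz⟩, hz1⟩
      obtain ⟨w, rfl⟩ := IsAlgClosed.exists_pow_nat_eq z two_pos
      have key : ∀ u : ℂ, u ^ 2 = w ^ 2 → aeval u (salemPoly m p) = 0 →
          w ^ 2 = ((s ^ 2 : ℝ) : ℂ) ∨ w ^ 2 = (((s ^ 2)⁻¹ : ℝ) : ℂ) := by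
        intro u hu hu0
        rw [← hu] at hz1 ⊢
        rcases hroots u hu0 with h | rfl | rfl
        · exact absurd (by rw [norm_pow, h, one_pow]) hz1
        · left; push_cast; rfl
        · right; push_cast; rw [inv_pow]
      rw [hsq] at hz
      rcases mul_eq_zero.1 hz with h | h
      · exact key w rfl h
      · exact key (-w) (neg_sq w) h
    · rintro (rfl | rfl)
      · refine ⟨⟨hne, ?_⟩, ?_⟩
        · have := aeval_algebraMap_apply ℂ (s ^ 2) (minpoly ℚ (s ^ 2))
          rwa [minpoly.aeval, map_zero] at this
        · rw [Complex.norm_real, Real.norm_of_nonneg (by positivity)]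
          nlinarith
      · refine ⟨⟨hne, ?_⟩, ?_⟩
        · rw [show (((s ^ 2)⁻¹ : ℝ) : ℂ) = ((s : ℂ)⁻¹) ^ 2 by push_cast; rw [inv_pow], hsq, hinv,
            zero_mul]
        · rw [Complex.norm_real, Real.norm_of_nonneg (by positivity), Ne, inv_eq_one]
          nlinarith
  · have := congrArg natDegree hcomp
    have hdegneg : ((minpoly ℚ s).comp (-X)).natDegree = 2 * m := by
      rw [natDegree_comp, natDegree_neg, natDegree_X, mul_one, hdeg]
    rw [natDegree_comp, natDegree_X_pow, natDegree_mul hmon.ne_zero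
      (by intro h; rw [h] at hdegneg; simp at hdegneg; lia), hdeg, hdegneg] at this
    lia
  · refine ⟨?_, 1, fun σ => by simp, (minpoly ℚ s).map (algebraMap ℚ ℝ), hmon.map _, ?_, ?_, ?_, ?_⟩
    · rintro _ ⟨x, rfl⟩
      exact IntermediateField.algebraMap_mem _ x
    · rw [reverse, hmon.natDegree_map, hdeg, minpoly_salemPoly hm hp hs0, reflect_map,
        reflect_map, reflect_salemPoly]
    · exact fun k _ => ⟨_, coeff_map _ _⟩
    · exact fun k _ => ⟨(minpoly ℚ s).coeff k, by rw [coeff_map]; simp⟩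
    · have := congrArg (Polynomial.map (algebraMap ℚ ℝ)) hcomp
      simpa [map_comp] using this

/-! ### Eisenstein polynomials and total ramification -/

/-- If the minimal polynomial of `t` is Eisenstein at `p`, the order `ℤ[t]` is maximal at `p`: some
multiple `N θ` of an algebraic integer `θ ∈ ℚ(t)`, with `N` prime to `p`, lies in `ℤ[t]`. -/
theorem exists_aeval_eq_mul_of_isEisensteinAt {p : ℕ} (hp : p.Prime) {t θ : ℝ}
    (ht : IsIntegral ℤ t) (he : (minpoly ℤ t).IsEisensteinAt (Ideal.span {(p : ℤ)}))
    (hθ : IsIntegral ℤ θ) (hmem : θ ∈ ℚ⟮t⟯) :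
    ∃ N : ℤ, ¬ (p : ℤ) ∣ N ∧ ∃ P : ℤ[X], aeval t P = N * θ := by
  have htQ : IsIntegral ℚ t := ht.tower_top
  let B := adjoin.powerBasis htQ
  have hgen : B.gen = AdjoinSimple.gen ℚ t := adjoin.powerBasis_gen htQ
  have hinj : Function.Injective (algebraMap ℚ⟮t⟯ ℝ) := (algebraMap ℚ⟮t⟯ ℝ).injective
  have hBt : algebraMap ℚ⟮t⟯ ℝ B.gen = t := by rw [hgen]; rfl
  have hBint : IsIntegral ℤ B.gen := (isIntegral_algebraMap_iff hinj).1 (hBt.symm ▸ ht)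
  have hBmin : minpoly ℤ B.gen = minpoly ℤ t := by
    rw [← minpoly.algebraMap_eq hinj, hBt]
  -- Clear all denominators first, then remove the factors `p`.
  obtain ⟨M, hM0, Q, hQ⟩ : ∃ M : ℤ, M ≠ 0 ∧ ∃ Q : ℤ[X], aeval t Q = M * θ := by
    have h : θ ∈ Algebra.adjoin ℚ {t} := by
      rwa [← adjoin_simple_toSubalgebra_of_isAlgebraic htQ.isAlgebraic]
    obtain ⟨q, rfl⟩ := Algebra.adjoin_singleton_eq_range_aeval ℚ t ▸ h
    obtain ⟨b, hb0, hb⟩ := IsLocalization.integerNormalization_spec (nonZeroDivisors ℤ) q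
    refine ⟨b, nonZeroDivisors.ne_zero hb0,
      IsLocalization.integerNormalization (nonZeroDivisors ℤ) q, ?_⟩
    rw [← aeval_map_algebraMap ℚ, hb, map_zsmul, zsmul_eq_mul]
    rfl
  obtain ⟨k, N, hN, rfl⟩ : ∃ (k : ℕ) (N : ℤ), ¬ (p : ℤ) ∣ N ∧ M = p ^ k * N := by
    have hfin : FiniteMultiplicity (p : ℤ) M :=
      FiniteMultiplicity.of_prime_left (Nat.prime_iff_prime_int.1 hp) hM0
    obtain ⟨N, hN, h⟩ := hfin.exists_eq_pow_mul_and_not_dvd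
    exact ⟨_, N, h, hN⟩
  refine ⟨N, hN, ?_⟩
  have hz : IsIntegral ℤ ((N : ℚ⟮t⟯) * ⟨θ, hmem⟩) := by
    refine (isIntegral_algebraMap_iff hinj).1 ?_
    rw [map_mul, map_intCast]
    exact (isIntegral_intCast N).mul hθ
  have hadj : (p : ℤ) ^ k • ((N : ℚ⟮t⟯) * ⟨θ, hmem⟩) ∈ Algebra.adjoin ℤ {B.gen} := by
    rw [Algebra.adjoin_singleton_eq_range_aeval]
    refine ⟨Q, hinj ?_⟩
    change algebraMap ℚ⟮t⟯ ℝ (aeval B.gen Q) = _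
    rw [← aeval_algebraMap_apply, hBt, hQ, zsmul_eq_mul, map_mul, map_mul, map_intCast, map_intCast]
    push_cast
    exact mul_assoc _ _ _
  have := mem_adjoin_of_smul_prime_pow_smul_of_minpoly_isEisensteinAt
    (Nat.prime_iff_prime_int.1 hp) hBint hz hadj (hBmin.symm ▸ he)
  rw [Algebra.adjoin_singleton_eq_range_aeval] at this
  obtain ⟨P, hP⟩ := this
  refine ⟨P, ?_⟩
  have h := congrArg (algebraMap ℚ⟮t⟯ ℝ) hP
  change algebraMap ℚ⟮t⟯ ℝ (aeval B.gen P) = _ at h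
  rwa [← aeval_algebraMap_apply, hBt, map_mul, map_intCast] at h

/-- If `t` is a root of an Eisenstein polynomial at `p`, then `p` is totally ramified in `ℚ(t)`:
the conjugates of an algebraic integer `θ ∈ ℚ(t)` are congruent modulo the primes above `p`. Hence
`p` divides the constant coefficient of the minimal polynomial of a difference of conjugates. -/
theorem dvd_coeff_zero_minpoly_sub_of_isEisensteinAt {p : ℕ} (hp : p.Prime) {t θ : ℝ}
    (ht : IsIntegral ℤ t) (he : (minpoly ℤ t).IsEisensteinAt (Ideal.span {(p : ℤ)}))
    (hθ : IsIntegral ℤ θ) (hmem : θ ∈ ℚ⟮t⟯) {θ₁ θ₂ : ℂ}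
    (h₁ : aeval θ₁ (minpoly ℚ θ) = 0) (h₂ : aeval θ₂ (minpoly ℚ θ) = 0) :
    (p : ℤ) ∣ (minpoly ℤ (θ₁ - θ₂)).coeff 0 := by
  have hpZ : Prime (p : ℤ) := Nat.prime_iff_prime_int.1 hp
  obtain ⟨N, hN, P, hP⟩ := exists_aeval_eq_mul_of_isEisensteinAt hp ht he hθ hmem
  have htQ : IsIntegral ℚ t := ht.tower_top
  -- A prime above `p` in the ring of all algebraic integers.
  let A := integralClosure ℤ ℂ
  obtain ⟨𝔓, h𝔓, hover⟩ : ∃ 𝔓 : Ideal A, 𝔓.IsPrime ∧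
      𝔓.comap (algebraMap ℤ A) = Ideal.span {(p : ℤ)} := by
    have : (Ideal.span {(p : ℤ)}).IsPrime := (Ideal.span_singleton_prime hpZ.ne_zero).2 hpZ
    obtain ⟨𝔓, -, h⟩ := Ideal.exists_ideal_over_prime_of_isIntegral (S := A)
      (Ideal.span {(p : ℤ)}) ⊥ (by
        rw [← RingHom.ker_eq_comap_bot, (RingHom.injective_iff_ker_eq_bot _).1
          (FaithfulSMul.algebraMap_injective ℤ A)]
        exact bot_le)
    exact ⟨𝔓, h⟩
  have hint𝔓 : ∀ x : ℤ, algebraMap ℤ A x ∈ 𝔓 ↔ (p : ℤ) ∣ x := fun x => by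
    rw [← Ideal.mem_comap, hover, Ideal.mem_span_singleton]
  have hroot : ∀ u : A, aeval u (minpoly ℤ t) = 0 → u ∈ 𝔓 := by
    intro u hu
    rw [aeval_eq_sum_range, Finset.sum_range_succ, (minpoly.monic ht).coeff_natDegree,
      one_smul] at hu
    refine h𝔓.mem_of_pow_mem (minpoly ℤ t).natDegree ?_
    rw [eq_neg_of_add_eq_zero_right hu]
    refine neg_mem (sum_mem fun i hi => ?_)
    rw [Algebra.smul_def]
    refine 𝔓.mul_mem_right _ ((hint𝔓 _).2 (Ideal.mem_span_singleton.1 (he.mem ?_)))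
    exact Finset.mem_range.1 hi
  have hconj : ∀ w : ℂ, aeval w (minpoly ℚ θ) = 0 → ∃ a : A, (a : ℂ) = w ∧
      algebraMap ℤ A N * a - algebraMap ℤ A (P.coeff 0) ∈ 𝔓 := by
    intro w hw
    obtain ⟨φ, hφ⟩ := exists_algHom_adjoin_of_splits_of_aeval (F := ℚ) (S := {t}) (K := ℂ)
      (fun s hs => ⟨by rwa [Set.mem_singleton_iff.1 hs], IsAlgClosed.splits _⟩) hmem hw
    have hwint : IsIntegral ℤ w := by
      rw [← hφ]
      refine IsIntegral.map (φ.restrictScalars ℤ) ?_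
      exact (isIntegral_algebraMap_iff (algebraMap ℚ⟮t⟯ ℝ).injective).1 hθ
    let τ : ℚ⟮t⟯ := AdjoinSimple.gen ℚ t
    have hτint : IsIntegral ℤ τ :=
      (isIntegral_algebraMap_iff (algebraMap ℚ⟮t⟯ ℝ).injective).1 ht
    let u : A := ⟨φ τ, hτint.map (φ.restrictScalars ℤ)⟩
    have hτmin : aeval τ (minpoly ℤ t) = 0 := by
      apply (algebraMap ℚ⟮t⟯ ℝ).injective
      rw [map_zero, ← aeval_algebraMap_apply, AdjoinSimple.algebraMap_gen, minpoly.aeval]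
    have hcoe : ∀ R : ℤ[X], ((aeval u R : A) : ℂ) = φ (aeval τ R) := fun R =>
      (aeval_algebraMap_apply ℂ u R).symm.trans
        (aeval_algHom_apply (φ.restrictScalars ℤ) τ R)
    have hu : u ∈ 𝔓 := by
      refine hroot u (Subtype.coe_injective ?_)
      change ((aeval u (minpoly ℤ t) : A) : ℂ) = 0
      rw [hcoe, hτmin, map_zero]
    refine ⟨⟨w, hwint⟩, rfl, ?_⟩
    have hPu : aeval u P = algebraMap ℤ A N * ⟨w, hwint⟩ := by
      have hPτ : aeval τ P = N * ⟨θ, hmem⟩ := by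
        apply (algebraMap ℚ⟮t⟯ ℝ).injective
        rw [← aeval_algebraMap_apply, AdjoinSimple.algebraMap_gen, hP, map_mul, map_intCast]
        rfl
      apply Subtype.coe_injective
      change ((aeval u P : A) : ℂ) = algebraMap ℤ ℂ N * w
      rw [hcoe, hPτ, map_mul, map_intCast, hφ]
      simp
    rw [← hPu]
    obtain ⟨R, hR⟩ := X_dvd_sub_C (p := P)
    have := congrArg (aeval u) hR
    rw [map_sub, aeval_C, map_mul, aeval_X] at this
    rw [this]
    exact 𝔓.mul_mem_right _ hu
  obtain ⟨a₁, rfl, h₁'⟩ := hconj θ₁ h₁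
  obtain ⟨a₂, rfl, h₂'⟩ := hconj θ₂ h₂
  have hdiff : a₁ - a₂ ∈ 𝔓 := by
    have h := 𝔓.sub_mem h₁' h₂'
    rw [sub_sub_sub_cancel_right, ← mul_sub] at h
    exact (h𝔓.mem_or_mem h).resolve_left fun h => hN ((hint𝔓 N).1 h)
  have hmin : aeval (a₁ - a₂) (minpoly ℤ ((a₁ : ℂ) - a₂)) = 0 :=
    Subtype.coe_injective ((aeval_algebraMap_apply ℂ (a₁ - a₂) _).symm.trans (minpoly.aeval _ _))
  rw [← hint𝔓]
  obtain ⟨R, hR⟩ := X_dvd_sub_C (p := minpoly ℤ ((a₁ : ℂ) - a₂))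
  have := congrArg (aeval (a₁ - a₂)) hR
  rw [map_sub, aeval_C, map_mul, aeval_X, hmin, zero_sub] at this
  rw [← neg_mem_iff, this]
  exact 𝔓.mul_mem_right _ hdiff

/-- A number field other than `ℚ` is not contained in `ℚ(s)` for all roots `s` of the polynomials
of the family: take `p` larger than the norm of a difference of two conjugates of an element. -/
theorem eq_bot_of_forall_le_adjoin {m : ℕ} (hm : 0 < m) {K : IntermediateField ℚ ℝ}
    [FiniteDimensional ℚ K]
    (hK : ∀ p : ℕ, p.Prime → ∀ s : ℝ, 1 < s → aeval s (salemPoly m p) = 0 → K ≤ ℚ⟮s⟯) :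
    K = ⊥ := by
  by_contra hbot
  obtain ⟨θ, hθK, hθ, hθbot⟩ :
      ∃ θ ∈ K, IsIntegral ℤ θ ∧ θ ∉ (⊥ : IntermediateField ℚ ℝ) := by
    obtain ⟨x, hxK, hx⟩ := SetLike.not_le_iff_exists.1 (fun h => hbot (le_bot_iff.1 h))
    have hxint : IsIntegral ℚ x :=
      (isIntegral_iff (S := K) (x := ⟨x, hxK⟩)).1 (Algebra.IsIntegral.isIntegral _)
    obtain ⟨y, hy0, hy⟩ := ((IsFractionRing.isAlgebraic_iff ℤ ℚ ℝ).2
      hxint.isAlgebraic).exists_integral_multiple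
    refine ⟨y • x, ?_, hy, fun h => hx ?_⟩
    · rw [zsmul_eq_mul]; exact mul_mem (intCast_mem K y) hxK
    · have hyR : (y : ℝ) ≠ 0 := by exact_mod_cast hy0
      rw [zsmul_eq_mul] at h
      have := mul_mem (inv_mem (intCast_mem (⊥ : IntermediateField ℚ ℝ) y)) h
      rwa [inv_mul_cancel_left₀ hyR] at this
  have hθQ : IsIntegral ℚ θ := hθ.tower_top
  have h₁ : aeval (θ : ℂ) (minpoly ℚ θ) = 0 := by
    have := aeval_algebraMap_apply ℂ θ (minpoly ℚ θ)
    rwa [minpoly.aeval, map_zero] at this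
  obtain ⟨θ', h₂, hne⟩ := exists_conjugate_ne hθQ fun h => hθbot (mem_bot.2 h)
  have hconjint : ∀ w : ℂ, aeval w (minpoly ℚ θ) = 0 → IsIntegral ℤ w := fun w hw => by
    refine ⟨minpoly ℤ θ, minpoly.monic hθ, ?_⟩
    rw [minpoly.isIntegrallyClosed_eq_field_fractions' ℚ hθ, aeval_map_algebraMap] at hw
    exact hw
  have hδ : IsIntegral ℤ (θ' - θ) := (hconjint _ h₂).sub (hconjint _ h₁)
  have hc : (minpoly ℤ (θ' - θ)).coeff 0 ≠ 0 := fun h => by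
    refine minpoly.coeff_zero_ne_zero (A := ℚ) hδ.tower_top (sub_ne_zero.2 hne) ?_
    rw [minpoly.isIntegrallyClosed_eq_field_fractions' ℚ hδ, coeff_map, h, map_zero]
  -- A prime too large to divide the norm of the difference of the two conjugates.
  obtain ⟨p, hpc, hp⟩ := Nat.exists_infinite_primes ((minpoly ℤ (θ' - θ)).coeff 0).natAbs.succ
  obtain ⟨s, hs, hs0⟩ := exists_real_root_salemPoly hm hp.two_le
  have hsint : IsIntegral ℤ s := ⟨_, monic_salemPoly hm p, hs0⟩
  have htint : IsIntegral ℤ (s - 1) := hsint.sub isIntegral_one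
  have hmin : minpoly ℤ (s - 1) = (salemPoly m p).comp (X + 1) := by
    apply map_injective (algebraMap ℤ ℚ) (algebraMap ℤ ℚ).injective_int
    have h := minpoly.sub_algebraMap (A := ℚ) s 1
    rw [map_one] at h
    rw [← minpoly.isIntegrallyClosed_eq_field_fractions' ℚ htint, h, minpoly_salemPoly hm hp hs0,
      map_comp]
    simp
  have hadj : ℚ⟮s - 1⟯ = ℚ⟮s⟯ := by
    refine le_antisymm (adjoin_simple_le_iff.2 (sub_mem (mem_adjoin_simple_self ℚ s) (one_mem _)))
      (adjoin_simple_le_iff.2 ?_)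
    have := add_mem (mem_adjoin_simple_self ℚ (s - 1)) (one_mem ℚ⟮s - 1⟯)
    rwa [sub_add_cancel] at this
  have hdvd := dvd_coeff_zero_minpoly_sub_of_isEisensteinAt hp htint
    (hmin ▸ isEisensteinAt_salemPoly_comp hm hp) hθ (hadj ▸ hK p hp s hs hs0 hθK) h₂ h₁
  have := Nat.le_of_dvd (Int.natAbs_pos.2 hc) (Int.natCast_dvd.1 hdvd)
  lia

end HypArith

/-- If a commensurability class of arithmetic groups of the first type in `Isom(ℍⁿ)` realizes all
Salem numbers of degree `2m` square-rootable over `ℚ`, where `2 ≤ 2m ≤ n + 1`, then its field of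
definition is `ℚ`: it is defined over `ℚ`, and over no other totally real number field in `ℝ`. -/
theorem mainTheorem5 (n m : ℕ) (hm : 2 ≤ 2 * m) (hmn : 2 * m ≤ n + 1)
    (C : Set (Subgroup (HypArith.IsomH n)))
    (hC : ∃ K : IntermediateField ℚ ℝ, HypArith.IsFirstTypeClass K C)
    (hreal : ∀ l ∈ HypArith.SalSq m, HypArith.ClassRealizes C l) :
    ∀ K : IntermediateField ℚ ℝ, HypArith.IsFirstTypeClass K C ↔ K = ⊥ := by
  have hm0 : 0 < m := by lia
  have key : ∀ K : IntermediateField ℚ ℝ, HypArith.IsFirstTypeClass K C → K = ⊥ := by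
    intro K hK
    have : NumberField K := by
      obtain ⟨_, ⟨h, -⟩, -⟩ := hK
      exact h
    refine HypArith.eq_bot_of_forall_le_adjoin hm0 fun p hp s hs hs0 => ?_
    have hl := HypArith.sq_mem_SalSq hm0 hp hs hs0
    have hs2 : s ^ 2 ∈ ℚ⟮s⟯ := pow_mem (mem_adjoin_simple_self ℚ s) 2
    refine (HypArith.le_adjoin_add_inv_of_realizes hK hl.1.1.tower_top hl.1.2.1
      (hreal _ hl)).trans ?_
    rw [adjoin_simple_le_iff]
    exact add_mem hs2 (inv_mem hs2)
  intro K
  refine ⟨key K, ?_⟩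
  rintro rfl
  obtain ⟨K, hK⟩ := hC
  exact key K hK ▸ hK
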